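/- Let $\kappa$ be a regular uncountable cardinal. For a set $C$ of ordinals let $\mathrm{acc}(C)=\{\alpha\in C : \sup(C\cap\alpha)=\alpha>0\}$ and $\mathrm{nacc}(C)=C\setminus\mathrm{acc}(C)$. Let $\mathrm{P}(\kappa,2,\sqsubseteq,\kappa)$ be the conjunction of $\diamondsuit(\kappa)$ and the existence of a sequence $\langle C_\alpha : \alpha<\kappa\rangle$ such that (i) for every $\alpha\in\mathrm{acc}(\kappa)$, $C_\alpha$ is a club in $\alpha$ (automatically of order type $\le\kappa$); (ii) for all $\alpha<\kappa$ and $\bar\alpha\in\mathrm{acc}(C_\alpha)$, $C_{\bar\alpha}=C_\alpha\cap\bar\alpha$; (iii) for every sequence $\langle B_i : i<\kappa\rangle$ of cofinal subsets of $\kappa$ there are stationarily many $\alpha<\kappa$ such that $\sup(\mathrm{nacc}(C_\alpha)\cap B_i)=\alpha$ for all $i<\alpha$. A streamlined $\kappa$-tree $T\subseteq{}^{<\kappa}\omega$ is a set of functions from ordinals below $\kappa$ to $\omega$, closed under restrictions to ordinals, such that each level $T_\alpha=T\cap{}^{\alpha}\omega$ ($\alpha<\kappa$) is nonempty and of size $<\kappa$;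 it is ordered by inclusion. It is $\kappa$-Aronszajn if it has no linearly ordered subset of size $\kappa$, and $\kappa$-Souslin if moreover it has no antichain of size $\kappa$. The height of a set $A\subseteq T$ is the least ordinal $\alpha$ with $A\cap T_\alpha=\emptyset$, and $A$ is a subtree of $T$ if it is downward closed in $T$ and has the same height as $T$. A $\varrho$-modification is a function $\eta:x\to\mathbb Z$ with $x\subseteq\mathrm{nacc}(\kappa)$ finite and $0\in x$. For $\tau\in{}^{<\kappa}\omega$ let $\eta*\tau$ be the function with domain $\mathrm{dom}(\tau)$ given by $\beta\mapsto\eta(\beta^-)+\tau(\beta)$, where $\beta^-=\max(x\cap(\beta+1))$, if all of these values lie in $\omega$, and $\eta*\tau=\emptyset$ otherwise. $T$ is uniformly $\varrho$-coherent if for all $\alpha<\kappa$ and $t,s\in T_\alpha$ there is a $\varrho$-modification $\eta$ with $\eta*t=s$, and $\eta*t\in T$ for all $t\in T$ and all $\varrho$-modifications $\eta$. For $s\in T$ and $i<\omega$, the frozen cone $T_{[s,i]}$ is the set of all $t\in T$ such that either $t\subseteq s$, or $s\subseteq t$ and $t(\xi)\ge i$ whenever $\mathrm{dom}(s)\le\xi<\mathrm{dom}(t)$.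 **Theorem.** Let $\kappa$ be a regular uncountable cardinal and suppose that $\mathrm{P}(\kappa,2,\sqsubseteq,\kappa)$ holds. Then there exists a uniformly $\varrho$-coherent streamlined $\kappa$-Aronszajn tree $T\subseteq{}^{<\kappa}\omega$ that is not $\kappa$-Souslin and such that every subtree of $T$ contains some frozen cone $T_{[s,i]}$ with $s\in T$, $\mathrm{dom}(s)\in\mathrm{nacc}(\kappa)$ and $i<\omega$. -/

import Mathlib

universe u

namespace ProxyTree

/-! ### Sets of ordinals -/

/-- Accumulation points of a set of ordinals `C` that belong to `C`:
those `α ∈ C` with `sup (C ∩ α) = α > 0`. -/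
def acc (C : Set Ordinal.{u}) : Set Ordinal.{u} :=
  {α | α ∈ C ∧ IsLUB (C ∩ Set.Iio α) α ∧ 0 < α}

/-- The non-accumulation points of a set of ordinals. -/
def nacc (C : Set Ordinal.{u}) : Set Ordinal.{u} :=
  C \ acc C

/-- `C` is a club (closed and unbounded) subset of the ordinal `α`. -/
def IsClubIn (C : Set Ordinal.{u}) (α : Ordinal.{u}) : Prop :=
  C ⊆ Set.Iio α ∧ IsClub {β : Set.Iio α | (β : Ordinal.{u}) ∈ C}

/-- The set `{α < κ | P α}` is stationary in `κ`. -/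
def StationarilyMany (κ : Cardinal.{u}) (P : Ordinal.{u} → Prop) : Prop :=
  IsStationary {α : Set.Iio κ.ord | P α}

/-- `B` is a cofinal subset of `κ`. -/
def IsCofinalSubset (κ : Cardinal.{u}) (B : Set Ordinal.{u}) : Prop :=
  B ⊆ Set.Iio κ.ord ∧ IsCofinalFor (Set.Iio κ.ord) B

/-! ### The proxy principle -/

/-- The sequence `⟨C_α | α < κ⟩` witnesses `P⁻_ξ(κ, 2, ⊑, κ)`.
Only the values of `C` at ordinals below `κ` matter. -/
structure IsProxySequence (ξ : Ordinal.{u}) (κ : Cardinal.{u})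
    (C : Ordinal.{u} → Set Ordinal.{u}) : Prop where
  club : ∀ α ∈ acc (Set.Iio κ.ord),
    IsClubIn (C α) α ∧
      Ordinal.type (fun a b : C α => a < b) ≤ Ordinal.lift.{u + 1} ξ
  coherent : ∀ α < κ.ord, ∀ β ∈ acc (C α), C β = C α ∩ Set.Iio β
  hitting : ∀ B : Ordinal.{u} → Set Ordinal.{u},
    (∀ i < κ.ord, IsCofinalSubset κ (B i)) →
      StationarilyMany κ (fun α => ∀ i < α, IsLUB (nacc (C α) ∩ B i) α)

/-- The principle `P⁻_ξ(κ, 2, ⊑, κ)`. -/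
def ProxyMinus (ξ : Ordinal.{u}) (κ : Cardinal.{u}) : Prop :=
  ∃ C : Ordinal.{u} → Set Ordinal.{u}, IsProxySequence ξ κ C

/-- Jensen's diamond principle `♢(κ)`. -/
def Diamond (κ : Cardinal.{u}) : Prop :=
  ∃ A : Ordinal.{u} → Set Ordinal.{u},
    (∀ α < κ.ord, A α ⊆ Set.Iio α) ∧
      ∀ X ⊆ Set.Iio κ.ord, StationarilyMany κ (fun α => X ∩ Set.Iio α = A α)

/-- The principle `P_ξ(κ, 2, ⊑, κ)`: the conjunction of `P⁻_ξ(κ, 2, ⊑, κ)` and `♢(κ)`. -/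
def ProxyXi (ξ : Ordinal.{u}) (κ : Cardinal.{u}) : Prop :=
  ProxyMinus ξ κ ∧ Diamond κ

/-- The principle `P(κ, 2, ⊑, κ)`, i.e. `P_ξ(κ, 2, ⊑, κ)` with `ξ = κ`. -/
def Proxy (κ : Cardinal.{u}) : Prop :=
  ProxyXi κ.ord κ

/-! ### Transfinite sequences of natural numbers -/

/-- A function `dom → ω` whose domain `dom` is an ordinal. It is stored as a function on all
ordinals which is `0` outside of `dom`, so that equal functions are equal as nodes. -/
@[ext]
structure Node : Type (u + 1) where
  dom : Ordinal.{u}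
  val : Ordinal.{u} → ℕ
  val_eq_zero : ∀ ξ, dom ≤ ξ → val ξ = 0

namespace Node

open Classical in
/-- The function `f` restricted to the ordinal `α`. -/
noncomputable def ofFun (α : Ordinal.{u}) (f : Ordinal.{u} → ℕ) : Node.{u} where
  dom := α
  val := fun ξ => if ξ < α then f ξ else 0
  val_eq_zero := fun _ h => if_neg (not_lt.mpr h)

/-- The empty function. -/
noncomputable def empty : Node.{u} := ofFun 0 (fun _ => 0)

/-- The restriction `t ↾ α`. -/
noncomputable def restrict (t : Node.{u}) (α : Ordinal.{u}) : Node.{u} :=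
  ofFun (min t.dom α) t.val

/-- Nodes are ordered by inclusion of functions: `s ≤ t` means that `t` extends `s`. -/
instance : PartialOrder Node.{u} where
  le s t := s.dom ≤ t.dom ∧ ∀ ξ < s.dom, s.val ξ = t.val ξ
  le_refl _ := ⟨le_rfl, fun _ _ => rfl⟩
  le_trans _ _ _ h₁ h₂ :=
    ⟨h₁.1.trans h₂.1, fun ξ hξ => (h₁.2 ξ hξ).trans (h₂.2 ξ (hξ.trans_le h₁.1))⟩
  le_antisymm s t h₁ h₂ := by
    have hd : s.dom = t.dom := le_antisymm h₁.1 h₂.1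
    refine Node.ext hd (funext fun ξ => ?_)
    rcases lt_or_ge ξ s.dom with h | h
    · exact h₁.2 ξ h
    · rw [s.val_eq_zero ξ h, t.val_eq_zero ξ (hd ▸ h)]

end Node

/-! ### Streamlined trees -/

/-- The level `T_α` of `T`, i.e. the elements of `T` with domain `α`. -/
def level (T : Set Node.{u}) (α : Ordinal.{u}) : Set Node.{u} :=
  {t | t ∈ T ∧ t.dom = α}

/-- `T ⊆ ^{<κ}ω` is a streamlined `κ`-tree. -/
structure IsStreamlinedTree (κ : Cardinal.{u}) (T : Set Node.{u}) : Prop where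
  dom_lt : ∀ t ∈ T, t.dom < κ.ord
  restrict_mem : ∀ t ∈ T, ∀ α < κ.ord, t.restrict α ∈ T
  level_nonempty : ∀ α < κ.ord, (level T α).Nonempty
  level_small : ∀ α < κ.ord, Cardinal.mk (level T α) < Cardinal.lift.{u + 1} κ

/-- `T` is a streamlined `κ`-Aronszajn tree: a streamlined `κ`-tree without branches
(linearly ordered subsets) of size `κ`. -/
def IsAronszajnTree (κ : Cardinal.{u}) (T : Set Node.{u}) : Prop :=
  IsStreamlinedTree κ T ∧
    ¬ ∃ B ⊆ T, IsChain (· ≤ ·) B ∧ Cardinal.mk B = Cardinal.lift.{u + 1} κ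

/-- `T` is a streamlined `κ`-Souslin tree: a streamlined `κ`-Aronszajn tree without antichains
of size `κ`. -/
def IsSouslinTree (κ : Cardinal.{u}) (T : Set Node.{u}) : Prop :=
  IsAronszajnTree κ T ∧
    ¬ ∃ X ⊆ T, IsAntichain (· ≤ ·) X ∧ Cardinal.mk X = Cardinal.lift.{u + 1} κ

/-- The downward closure in `T` of a set of nodes. -/
def downClosure (T X : Set Node.{u}) : Set Node.{u} :=
  {z | z ∈ T ∧ ∃ x ∈ X, z ≤ x}

/-- The height of a set of nodes: the least ordinal that is not the domain of a member. -/
noncomputable def height (A : Set Node.{u}) : Ordinal.{u} :=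
  sInf {α | level A α = ∅}

/-- `A` is a subtree of `T`: a downward closed subset of the same height. -/
def IsSubtree (T A : Set Node.{u}) : Prop :=
  A ⊆ T ∧ downClosure T A = A ∧ height A = height T

/-! ### ϱ-modifications -/

/-- A `ϱ`-modification: a function to `ℤ` whose domain is a finite subset of `nacc(κ)` that
contains `0`. It is stored as a function on all ordinals which is `0` outside of its domain. -/
structure RhoMod (κ : Cardinal.{u}) where
  dom : Finset Ordinal.{u}
  val : Ordinal.{u} → ℤ
  val_eq_zero : ∀ β, β ∉ dom → val β = 0
  dom_subset : ∀ β ∈ dom, β ∈ nacc (Set.Iio κ.ord)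
  zero_mem : 0 ∈ dom

namespace RhoMod

variable {κ : Cardinal.{u}}

/-- `β⁻`, the largest element of the domain of `η` that is `≤ β`. -/
noncomputable def pred (η : RhoMod κ) (β : Ordinal.{u}) : Ordinal.{u} :=
  (η.dom.filter (fun γ => γ ≤ β)).max'
    ⟨0, Finset.mem_filter.mpr ⟨η.zero_mem, bot_le⟩⟩

open Classical in
/-- The modification `η * τ`: the function `β ↦ η(β⁻) + τ(β)` on the domain of `τ` if all of its
values are nonnegative, and the empty function otherwise. -/
noncomputable def star (η : RhoMod κ) (τ : Node.{u}) : Node.{u} :=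
  if ∀ β < τ.dom, 0 ≤ η.val (η.pred β) + (τ.val β : ℤ) then
    Node.ofFun τ.dom (fun β => (η.val (η.pred β) + (τ.val β : ℤ)).toNat)
  else Node.empty

end RhoMod

/-- `T` is `ϱ`-coherent. -/
def IsRhoCoherent (κ : Cardinal.{u}) (T : Set Node.{u}) : Prop :=
  ∀ α < κ.ord, ∀ t ∈ level T α, ∀ s ∈ level T α, ∃ η : RhoMod κ, η.star t = s

/-- `T` is `ϱ`-uniform. -/
def IsRhoUniform (κ : Cardinal.{u}) (T : Set Node.{u}) : Prop :=
  ∀ t ∈ T, ∀ η : RhoMod κ, η.star t ∈ T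

/-- `T` is uniformly `ϱ`-coherent. -/
def IsUniformlyRhoCoherent (κ : Cardinal.{u}) (T : Set Node.{u}) : Prop :=
  IsRhoCoherent κ T ∧ IsRhoUniform κ T

/-! ### Frozen cones -/

/-- `t` is an `i`-extension of `s`. -/
def IsExtension (i : ℕ) (s t : Node.{u}) : Prop :=
  s ≤ t ∧ ∀ ξ, s.dom ≤ ξ → ξ < t.dom → i ≤ t.val ξ

/-- The frozen cone `T_{[s,i]}`. -/
def frozenCone (T : Set Node.{u}) (s : Node.{u}) (i : ℕ) : Set Node.{u} :=
  {t | t ∈ T ∧ (t ≤ s ∨ IsExtension i s t)}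

end ProxyTree

/-!
The tree consists of all sequences that differ by a step function from a member of one coherent
sequence `⟨b α | α < κ⟩`, where `b α : α → ω`, and a step function has finitely many jumps, none of
them at a limit. Such a tree is uniformly `ϱ`-coherent, and its levels have size `< κ`, for any
coherent `b` (`IsCoherentSeq.isStreamlinedTree`, `treeOf_isUniformlyRhoCoherent`). It is never
Souslin: the nodes that are positive except for a final `0` contain an antichain of size `κ`
(`treeOf_not_isSouslinTree`). A frozen cone contains incompatible nodes, so the tree is Aronszajn
once each of its subtrees contains a frozen cone (`IsCoherentSeq.isAronszajnTree`).

The sequence `b` is built by recursion (`stage`). At successors a `0` is appended. At a limit `α`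
one climbs along the club `C α` of the proxy sequence: from a point `δ` of `C α` to the next point
`β`, the node reached so far is extended to one of length `β` that is coherent with `b β`, and
`b α` is the union of these nodes. Since `C β = C α ∩ β` at the accumulation points `β` of `C α`,
the climb passes through `b β` there, so the recursion goes on and `b` is coherent (`isGoodAt`).

A node of limit length `δ` has only one candidate for an extension by one place, because step
functions do not jump at `δ`; this candidate could be negative at `δ`. To prevent this, each step
of a climb puts a zero somewhere, unless it leads from a limit to its successor. Then the zeros of
`b δ` are cofinal in every limit `δ`, so `b (δ + 1)` is at `δ` at least its values at cofinally
many earlier places, and a step function that keeps the values before `δ` nonnegative also keeps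
the value at `δ` nonnegative (`IsLscAtLimits`, `exists_extension`).

Suppose that a subtree `A` contains no frozen cone. Given a modification `η` with last value `e`,
the modification by `η` of any node, if it makes sense, can be extended outside `A` with new values
`≥ e`, and then `e` can be subtracted again: the node has an extension whose modification by `η` is
not in `A` (`IsCoherentSeq.exists_isEscape`). The climb takes such extensions (`sealRule`) whenever
the diamond sequence guesses at `β` a pair of `η` and the complement of `A`. The hitting property,
applied to the sets of places where the guess for `η` is correct, gives an `α` such that for every
`η` living below `α` a correct guess for `η` was met while climbing to `α`
(`exists_frozenCone_subset`). Hence no modification of `b α` to a node of length `α` is in `A`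
(`notMem_of_guess`), so `A` misses the level `α`.
-/

namespace ProxyTree

open Order Set

/-! ### Ordinals below a regular cardinal -/

section Ordinals

variable {κ : Cardinal.{u}}

theorem mem_acc_iff {C : Set Ordinal.{u}} {β : Ordinal.{u}} :
    β ∈ acc C ↔ β ∈ C ∧ 0 < β ∧ ∀ γ < β, ∃ δ ∈ C, γ < δ ∧ δ < β := by
  constructor
  · rintro ⟨h, hl, h0⟩
    refine ⟨h, h0, fun γ hγ => ?_⟩
    obtain ⟨δ, hδ, hγδ⟩ := (lt_isLUB_iff hl).1 hγ
    exact ⟨δ, hδ.1, hγδ, hδ.2⟩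
  · rintro ⟨h, h0, hl⟩
    refine ⟨h, ⟨fun x hx => hx.2.le, fun b hb => ?_⟩, h0⟩
    by_contra hlt
    obtain ⟨δ, hδ, h1, h2⟩ := hl b (not_le.1 hlt)
    exact absurd (hb ⟨hδ, h2⟩) (not_le.2 h1)

theorem isSuccLimit_of_mem_acc {C : Set Ordinal.{u}} {β : Ordinal.{u}} (h : β ∈ acc C) :
    IsSuccLimit β := by
  obtain ⟨_, h0, hl⟩ := mem_acc_iff.1 h
  refine Ordinal.isSuccLimit_iff.2 ⟨h0.ne', isSuccPrelimit_of_succ_lt fun γ hγ => ?_⟩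
  obtain ⟨δ, _, h1, h2⟩ := hl γ hγ
  exact (succ_le_of_lt h1).trans_lt h2

theorem mem_acc_Iio_iff {β : Ordinal.{u}} :
    β ∈ acc (Iio κ.ord) ↔ β < κ.ord ∧ IsSuccLimit β := by
  refine ⟨fun h => ⟨h.1, isSuccLimit_of_mem_acc h⟩, fun ⟨h, hl⟩ => ?_⟩
  refine mem_acc_iff.2 ⟨h, hl.bot_lt, fun γ hγ => ?_⟩
  exact ⟨succ γ, (hl.succ_lt hγ).trans h, lt_succ γ, hl.succ_lt hγ⟩

theorem mem_nacc_Iio_iff {β : Ordinal.{u}} :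
    β ∈ nacc (Iio κ.ord) ↔ β < κ.ord ∧ ¬ IsSuccLimit β := by
  rw [nacc, mem_sdiff, mem_acc_Iio_iff, mem_Iio]
  tauto

theorem not_isSuccLimit_add_one (β : Ordinal.{u}) : ¬ IsSuccLimit (β + 1) :=
  fun h => (h.succ_lt (lt_add_one β)).ne rfl

theorem add_one_lt_ord (hκ : Cardinal.aleph0 ≤ κ) {β : Ordinal.{u}} (h : β < κ.ord) :
    β + 1 < κ.ord :=
  (Cardinal.isSuccLimit_ord hκ).succ_lt h

/-- Fewer than `κ` ordinals below a regular `κ` have a strict upper bound below `κ`. The index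
type lives one universe up, where nodes and modifications live. -/
theorem exists_bound (hreg : κ.IsRegular) {X : Type (u + 1)}
    (hX : Cardinal.mk X < Cardinal.lift.{u + 1} κ) (f : X → Ordinal.{u})
    (hf : ∀ x, f x < κ.ord) : ∃ o < κ.ord, ∀ x, f x < o := by
  obtain ⟨a, ha, hXa⟩ := Cardinal.lt_lift_iff.1 hX
  induction a using Cardinal.inductionOn with
  | mk Y =>
    have e : Nonempty (Y ≃ X) := by
      rw [← Cardinal.lift_mk_eq'.{u, u + 1}, hXa, Cardinal.lift_id'.{u, u + 1}]
    obtain ⟨e⟩ := e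
    refine ⟨⨆ y : Y, (f (e y) + 1), ?_, fun x => ?_⟩
    · exact Ordinal.iSup_lt_of_lt_cof (by rwa [hreg.cof_ord])
        fun y => add_one_lt_ord hreg.aleph0_le (hf _)
    · have := Ordinal.lt_iSup_add_one (fun y => f (e y)) (e.symm x)
      simpa using this

theorem mk_Iio_lt_lift {α : Ordinal.{u}} (h : α < κ.ord) :
    Cardinal.mk (Iio α) < Cardinal.lift.{u + 1} κ := by
  rw [Cardinal.mk_Iio_ordinal, Cardinal.lift_lt]
  exact Cardinal.lt_ord.1 h

theorem aleph0_lt_lift (hunc : Cardinal.aleph0 < κ) :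
    Cardinal.aleph0 < Cardinal.lift.{u + 1} κ :=
  Cardinal.aleph0_lt_lift.2 hunc

/-- A stationary set meets the club of ordinals closed under a function. -/
theorem StationarilyMany.exists_closed (hreg : κ.IsRegular) (hunc : Cardinal.aleph0 < κ)
    {P : Ordinal.{u} → Prop} (hP : StationarilyMany κ P) (f : Ordinal.{u} → Ordinal.{u})
    (hf : ∀ δ < κ.ord, f δ < κ.ord) {γ : Ordinal.{u}} (hγ : γ < κ.ord) :
    ∃ α < κ.ord, γ < α ∧ P α ∧ ∀ δ < α, f δ < α := by
  have hclub : IsClub {α : Iio κ.ord | γ < α ∧ ∀ δ < α.1, f δ < α} := by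
    constructor
    · intro d hd hne _ a ha
      obtain ⟨x, hx⟩ := hne
      refine ⟨(hd hx).1.trans_le (ha.1 hx), fun δ hδ => ?_⟩
      have hδ' : (⟨δ, hδ.trans a.2⟩ : Iio κ.ord) < a := hδ
      obtain ⟨y, hy, hδy⟩ := (lt_isLUB_iff ha).1 hδ'
      exact ((hd hy).2 δ hδy).trans_le (ha.1 hy)
    · intro x
      have hstep : ∀ β : Iio κ.ord, ∃ β' : Iio κ.ord, β.1 < β' ∧ ∀ δ < β.1, f δ < β' := by
        intro β
        obtain ⟨o, ho, h⟩ := exists_bound hreg (mk_Iio_lt_lift β.2) (fun δ => f δ)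
          (fun δ => hf _ (lt_trans δ.2 β.2))
        exact ⟨⟨max o (β + 1), max_lt ho (add_one_lt_ord hreg.aleph0_le β.2)⟩,
          lt_max_of_lt_right (lt_add_one _), fun δ hδ => lt_max_of_lt_left (h ⟨δ, hδ⟩)⟩
      choose F hF1 hF2 using hstep
      let x₀ : Iio κ.ord := ⟨max x (γ + 1), max_lt x.2 (add_one_lt_ord hreg.aleph0_le hγ)⟩
      let s : ℕ → Iio κ.ord := fun n => F^[n] x₀
      have hs : ∀ n, s (n + 1) = F (s n) := fun n => Function.iterate_succ_apply' F n x₀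
      obtain ⟨o, ho, hb⟩ := exists_bound hreg (X := ULift.{u + 1} ℕ)
        (by simpa using hunc) (fun n => (s n.down).1) (fun n => (s n.down).2)
      have hbdd : BddAbove (range fun n => (s n).1) :=
        ⟨o, by rintro _ ⟨n, rfl⟩; exact (hb ⟨n⟩).le⟩
      have hle : ∀ n, (s n).1 ≤ ⨆ n, (s n).1 := le_ciSup hbdd
      refine ⟨⟨⨆ n, (s n).1, (ciSup_le fun n => (hb ⟨n⟩).le).trans_lt ho⟩, ⟨?_, ?_⟩, ?_⟩
      · exact (lt_max_of_lt_right (lt_add_one γ)).trans_le (hle 0)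
      · intro δ hδ
        obtain ⟨n, hn⟩ := exists_lt_of_lt_ciSup hδ
        refine (hF2 (s n) δ hn).trans_le ?_
        rw [← hs]
        exact hle _
      · exact (le_max_left x.1 (γ + 1)).trans (hle 0)
  obtain ⟨α, hα, h1, h2⟩ := hP hclub
  exact ⟨α, α.2, h1, hα, h2⟩

end Ordinals

/-! ### Step functions and coherence -/

section StepFunctions

/-- `g` is a step function: it has finitely many jumps, none of them at a limit ordinal. The set
`D` of possible jumps is allowed to be too large. -/
def IsStep (g : Ordinal.{u} → ℤ) : Prop :=
  ∃ D : Finset Ordinal.{u}, (∀ d ∈ D, ¬ IsSuccLimit d) ∧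
    ∀ β γ, (∀ d ∈ D, d ≤ β ↔ d ≤ γ) → g β = g γ

theorem IsStep.const (c : ℤ) : IsStep.{u} fun _ => c :=
  ⟨∅, by simp, fun _ _ _ => rfl⟩

theorem IsStep.neg {g : Ordinal.{u} → ℤ} (hg : IsStep g) : IsStep fun β => - g β := by
  obtain ⟨D, hD, h⟩ := hg
  exact ⟨D, hD, fun β γ hβγ => congrArg Neg.neg (h β γ hβγ)⟩

theorem IsStep.add {g h : Ordinal.{u} → ℤ} (hg : IsStep g) (hh : IsStep h) :
    IsStep fun β => g β + h β := by
  classical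
  obtain ⟨D, hD, h1⟩ := hg
  obtain ⟨E, hE, h2⟩ := hh
  refine ⟨D ∪ E, fun d hd => ?_, fun β γ hβγ => ?_⟩
  · rcases Finset.mem_union.1 hd with hd | hd
    exacts [hD d hd, hE d hd]
  · exact congrArg₂ (· + ·) (h1 β γ fun d hd => hβγ d (Finset.mem_union_left _ hd))
      (h2 β γ fun d hd => hβγ d (Finset.mem_union_right _ hd))

open Classical in
theorem IsStep.cut {g h : Ordinal.{u} → ℤ} (hg : IsStep g) (hh : IsStep h) {δ : Ordinal.{u}}
    (hδ : ¬ IsSuccLimit δ) : IsStep fun β => if β < δ then g β else h β := by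
  obtain ⟨D, hD, h1⟩ := hg
  obtain ⟨E, hE, h2⟩ := hh
  refine ⟨insert δ (D ∪ E), fun d hd => ?_, fun β γ hβγ => ?_⟩
  · rcases Finset.mem_insert.1 hd with rfl | hd
    · exact hδ
    · rcases Finset.mem_union.1 hd with hd | hd
      exacts [hD d hd, hE d hd]
  · have hiff : β < δ ↔ γ < δ := by
      rw [← not_le, ← not_le, hβγ δ (Finset.mem_insert_self _ _)]
    have e1 := h1 β γ fun d hd => hβγ d (by simp [hd])
    have e2 := h2 β γ fun d hd => hβγ d (by simp [hd])
    simp only [hiff, e1, e2]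

/-- A step function is constant on a closed final segment below each limit ordinal. -/
theorem IsStep.eventually_const {g : Ordinal.{u} → ℤ} (hg : IsStep g) {δ : Ordinal.{u}}
    (hδ : IsSuccLimit δ) : ∃ γ < δ, ∀ ξ, γ ≤ ξ → ξ ≤ δ → g ξ = g δ := by
  classical
  obtain ⟨D, hD, h⟩ := hg
  refine ⟨(D.filter (· < δ)).sup id, ?_, fun ξ h1 h2 => h _ _ fun d hd => ?_⟩
  · rw [Finset.sup_lt_iff hδ.bot_lt]
    exact fun d hd => (Finset.mem_filter.1 hd).2
  · refine ⟨fun h => h.trans h2, fun h => ?_⟩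
    have hlt : d < δ := lt_of_le_of_ne h fun e => hD d hd (e ▸ hδ)
    exact (Finset.le_sup (f := id) (b := d) (by simp [hd, hlt])).trans h1

/-- Two sequences of length `α` are coherent if they differ by a step function. -/
def Coh (α : Ordinal.{u}) (f g : Ordinal.{u} → ℕ) : Prop :=
  ∃ h, IsStep h ∧ ∀ ξ < α, (f ξ : ℤ) = g ξ + h ξ

variable {α β : Ordinal.{u}} {f g h : Ordinal.{u} → ℕ}

theorem Coh.of_eq (h : ∀ ξ < α, f ξ = g ξ) : Coh α f g :=
  ⟨fun _ => 0, .const 0, fun ξ hξ => by simp [h ξ hξ]⟩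

theorem Coh.refl (α : Ordinal.{u}) (f : Ordinal.{u} → ℕ) : Coh α f f :=
  .of_eq fun _ _ => rfl

theorem Coh.symm (hfg : Coh α f g) : Coh α g f := by
  obtain ⟨k, hk, e⟩ := hfg
  exact ⟨_, hk.neg, fun ξ hξ => by rw [e ξ hξ]; ring⟩

theorem Coh.trans (hfg : Coh α f g) (hgh : Coh α g h) : Coh α f h := by
  obtain ⟨k, hk, e⟩ := hfg
  obtain ⟨l, hl, e'⟩ := hgh
  exact ⟨_, hl.add hk, fun ξ hξ => by rw [e ξ hξ, e' ξ hξ]; ring⟩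

theorem Coh.mono (hfg : Coh β f g) (hαβ : α ≤ β) : Coh α f g := by
  obtain ⟨k, hk, e⟩ := hfg
  exact ⟨k, hk, fun ξ hξ => e ξ (hξ.trans_le hαβ)⟩

open Classical in
/-- Changing a sequence at one non-limit place keeps it coherent. -/
theorem Coh.update (α : Ordinal.{u}) (f : Ordinal.{u} → ℕ) {ρ : Ordinal.{u}}
    (hρ : ¬ IsSuccLimit ρ) (n : ℕ) : Coh α (Function.update f ρ n) f := by
  refine ⟨fun β => if β < ρ then 0 else if β < ρ + 1 then (n : ℤ) - f ρ else 0,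
    .cut (.const 0) (.cut (.const _) (.const 0) (not_isSuccLimit_add_one ρ)) hρ,
    fun ξ _ => ?_⟩
  rcases lt_trichotomy ξ ρ with h | rfl | h
  · simp [h.ne, h]
  · simp
  · have : ¬ ξ < ρ + 1 := not_lt.2 (add_one_le_iff.2 h)
    simp [h.ne', h.not_gt, this]

/-- The value at each limit place is at least the lower limit of the values before it. -/
def IsLscAtLimits (α : Ordinal.{u}) (f : Ordinal.{u} → ℕ) : Prop :=
  ∀ δ < α, IsSuccLimit δ → ∀ γ < δ, ∃ ξ, γ ≤ ξ ∧ ξ < δ ∧ f ξ ≤ f δ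

theorem Coh.exists_le_at_limit {δ : Ordinal.{u}} (hgf : Coh (δ + 1) g f) (hl : IsSuccLimit δ)
    (hf : ∀ γ < δ, ∃ ξ, γ ≤ ξ ∧ ξ < δ ∧ f ξ ≤ f δ) :
    ∀ γ < δ, ∃ ξ, γ ≤ ξ ∧ ξ < δ ∧ g ξ ≤ g δ := by
  obtain ⟨k, hk, e⟩ := hgf
  intro γ hγ
  obtain ⟨γ', hγ', hc⟩ := hk.eventually_const hl
  obtain ⟨ξ, h1, h2, h3⟩ := hf (max γ γ') (max_lt hγ hγ')
  refine ⟨ξ, (le_max_left _ _).trans h1, h2, ?_⟩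
  have e1 := e ξ (h2.trans (lt_add_one δ))
  have e2 := e δ (lt_add_one δ)
  rw [hc ξ ((le_max_right _ _).trans h1) h2.le] at e1
  omega

theorem IsLscAtLimits.congr (hf : IsLscAtLimits α f) (hgf : Coh α g f) : IsLscAtLimits α g :=
  fun δ hδ hl => (hgf.mono (add_one_le_iff.2 hδ)).exists_le_at_limit hl (hf δ hδ hl)

/-- If adding a step function keeps the values below a limit place nonnegative, then it does so
at that place. -/
theorem IsLscAtLimits.nonneg_at_limit (hf : IsLscAtLimits α f) {k : Ordinal.{u} → ℤ}
    (hk : IsStep k) {δ : Ordinal.{u}} (hδ : δ < α) (hl : IsSuccLimit δ)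
    (h : ∀ ξ < δ, 0 ≤ (f ξ : ℤ) + k ξ) : 0 ≤ (f δ : ℤ) + k δ := by
  obtain ⟨γ, hγ, hc⟩ := hk.eventually_const hl
  obtain ⟨ξ, h1, h2, h3⟩ := hf δ hδ hl γ hγ
  have := h ξ h2
  rw [hc ξ h1 h2.le] at this
  omega

open Classical in
/-- A sequence `s` of length `δ` that is coherent with `f` extends to one of length `α` that is
coherent with `f`, with large values at all new places but `δ`, and also at `δ` unless it is a
limit. -/
theorem exists_extension (hf : IsLscAtLimits α f) {δ : Ordinal.{u}} {s : Ordinal.{u} → ℕ}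
    (hδ : δ ≤ α) (hs : Coh δ s f) (N : ℕ) :
    ∃ t, Coh α t f ∧ (∀ ξ < δ, t ξ = s ξ) ∧
      ∀ ξ, δ ≤ ξ → (ξ = δ → ¬ IsSuccLimit δ) → N ≤ t ξ := by
  obtain ⟨k, hk, e⟩ := hs
  by_cases hl : IsSuccLimit δ
  · let k' : Ordinal.{u} → ℤ := fun β => if β < δ + 1 then k β else N
    have hk' : IsStep k' := hk.cut (.const N) (not_isSuccLimit_add_one δ)
    refine ⟨fun ξ => (f ξ + k' ξ).toNat, ⟨k', hk', fun ξ hξ => Int.toNat_of_nonneg ?_⟩,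
      fun ξ hξ => ?_, fun ξ h1 h2 => ?_⟩
    · rcases lt_trichotomy ξ δ with h | rfl | h
      · have : ξ < δ + 1 := h.trans (lt_add_one δ)
        simp only [k', this, if_true, ← e ξ h]
        positivity
      · simp only [k', lt_add_one ξ, if_true]
        exact hf.nonneg_at_limit hk hξ hl fun ζ hζ => by rw [← e ζ hζ]; positivity
      · have : ¬ ξ < δ + 1 := not_lt.2 (add_one_le_iff.2 h)
        simp only [k', this, if_false]
        positivity
    · have : ξ < δ + 1 := hξ.trans (lt_add_one δ)
      simp only [k', this, if_true, ← e ξ hξ, Int.toNat_natCast]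
    · have hlt : δ < ξ := lt_of_le_of_ne h1 fun h => h2 h.symm hl
      have : ¬ ξ < δ + 1 := not_lt.2 (add_one_le_iff.2 hlt)
      simp only [k', this, if_false]
      omega
  · let k' : Ordinal.{u} → ℤ := fun β => if β < δ then k β else N
    have hk' : IsStep k' := hk.cut (.const N) hl
    refine ⟨fun ξ => (f ξ + k' ξ).toNat, ⟨k', hk', fun ξ hξ => Int.toNat_of_nonneg ?_⟩,
      fun ξ hξ => ?_, fun ξ h1 h2 => ?_⟩
    · by_cases h : ξ < δ
      · simp only [k', h, if_true, ← e ξ h]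
        positivity
      · simp only [k', h, if_false]
        positivity
    · simp only [k', hξ, if_true, ← e ξ hξ, Int.toNat_natCast]
    · simp only [k', not_lt.2 h1, if_false]
      omega

/-- The requirements on the extension `t` to length `β` of a sequence `s` of length `δ`, where `f`
is the prescribed sequence of length `β`: coherence with `f`, and a zero at some new place unless
the only new place is a limit, where the value is determined by `s`. -/
def IsAdmissible (β : Ordinal.{u}) (f : Ordinal.{u} → ℕ) (δ : Ordinal.{u})
    (s t : Ordinal.{u} → ℕ) : Prop :=
  Coh β t f ∧ (∀ ξ < δ, t ξ = s ξ) ∧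
    ((∃ ξ, δ ≤ ξ ∧ ξ < β ∧ t ξ = 0) ∨ β = δ + 1 ∧ IsSuccLimit δ)

open Classical in
theorem IsAdmissible.update {δ ρ : Ordinal.{u}} {s t : Ordinal.{u} → ℕ} (ht : Coh β t f)
    (hts : ∀ ξ < δ, t ξ = s ξ) (hδρ : δ ≤ ρ) (hρβ : ρ < β) (hρ : ¬ IsSuccLimit ρ) :
    IsAdmissible β f δ s (Function.update t ρ 0) := by
  refine ⟨(Coh.update β t hρ 0).trans ht, fun ξ hξ => ?_, .inl ⟨ρ, hδρ, hρβ, by simp⟩⟩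
  rw [Function.update_of_ne (hξ.trans_le hδρ).ne, hts ξ hξ]

theorem exists_isAdmissible (hf : IsLscAtLimits β f) {δ : Ordinal.{u}} {s : Ordinal.{u} → ℕ}
    (hδ : δ < β) (hs : Coh δ s f) : ∃ t, IsAdmissible β f δ s t := by
  obtain ⟨t, ht, hts, -⟩ := exists_extension hf hδ.le hs 0
  by_cases hl : IsSuccLimit δ
  · rcases (add_one_le_iff.2 hδ).eq_or_lt with h | h
    · exact ⟨t, ht, hts, .inr ⟨h.symm, hl⟩⟩
    · exact ⟨_, .update ht hts (lt_add_one δ).le h (not_isSuccLimit_add_one δ)⟩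
  · exact ⟨_, .update ht hts le_rfl hδ hl⟩

end StepFunctions

/-! ### Modifications -/

namespace RhoMod

variable {κ : Cardinal.{u}}

theorem pred_mem (η : RhoMod κ) (β : Ordinal.{u}) : η.pred β ∈ η.dom :=
  (Finset.mem_filter.1 (Finset.max'_mem _ _)).1

theorem pred_le (η : RhoMod κ) (β : Ordinal.{u}) : η.pred β ≤ β :=
  (Finset.mem_filter.1 (Finset.max'_mem (η.dom.filter fun γ => γ ≤ β) _)).2

theorem le_pred (η : RhoMod κ) {β d : Ordinal.{u}} (hd : d ∈ η.dom) (h : d ≤ β) :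
    d ≤ η.pred β :=
  Finset.le_max' _ d (by simp [hd, h])

/-- The function `β ↦ η(β⁻)`. -/
noncomputable def step (η : RhoMod κ) (β : Ordinal.{u}) : ℤ :=
  η.val (η.pred β)

theorem isStep_step (η : RhoMod κ) : IsStep η.step := by
  refine ⟨η.dom, fun d hd => (mem_nacc_Iio_iff.1 (η.dom_subset d hd)).2, fun β γ h => ?_⟩
  have : η.pred β = η.pred γ := le_antisymm
    (η.le_pred (η.pred_mem β) ((h _ (η.pred_mem β)).1 (η.pred_le β)))
    (η.le_pred (η.pred_mem γ) ((h _ (η.pred_mem γ)).2 (η.pred_le γ)))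
  rw [step, step, this]

/-- A modification is constant from any bound of its domain on. -/
theorem step_eq_of_le (η : RhoMod κ) {δ ξ : Ordinal.{u}} (h : ∀ d ∈ η.dom, d ≤ δ) (hξ : δ ≤ ξ) :
    η.step ξ = η.step δ := by
  have : η.pred ξ = η.pred δ := le_antisymm
    (η.le_pred (η.pred_mem ξ) (h _ (η.pred_mem ξ)))
    (η.le_pred (η.pred_mem δ) ((η.pred_le δ).trans hξ))
  rw [step, step, this]

open Classical in
/-- Below `α ≤ κ`, every step function is given by a modification whose domain lies below `α`,
apart from the obligatory `0`. -/
theorem exists_step_eq (hκ : 0 < κ.ord) {g : Ordinal.{u} → ℤ} (hg : IsStep g) {α : Ordinal.{u}}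
    (hα : α ≤ κ.ord) :
    ∃ η : RhoMod κ, (∀ d ∈ η.dom, d < α ∨ d = 0) ∧ ∀ β < α, η.step β = g β := by
  obtain ⟨D, hD, h⟩ := hg
  let E : Finset Ordinal.{u} := insert 0 (D.filter (· < α))
  have hE : ∀ d ∈ E, d = 0 ∨ d ∈ D ∧ d < α := fun d hd => by simpa [E] using hd
  let η : RhoMod κ :=
    { dom := E
      val := fun β => if β ∈ E then g β else 0
      val_eq_zero := fun β hβ => if_neg hβ
      dom_subset := fun β hβ => mem_nacc_Iio_iff.2 <| by
        rcases hE β hβ with rfl | ⟨h1, h2⟩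
        · exact ⟨hκ, fun h => h.not_isMin isMin_bot⟩
        · exact ⟨h2.trans_le hα, hD β h1⟩
      zero_mem := Finset.mem_insert_self _ _ }
  refine ⟨η, fun d hd => ?_, fun β hβ => ?_⟩
  · rcases hE d hd with h | h
    exacts [.inr h, .inl h.2]
  · have hval : η.step β = g (η.pred β) := if_pos (η.pred_mem β)
    rw [hval]
    refine h _ _ fun d hd => ⟨fun h => h.trans (η.pred_le β), fun h => ?_⟩
    exact η.le_pred (Finset.mem_insert_of_mem (Finset.mem_filter.2 ⟨hd, h.trans_lt hβ⟩)) h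

theorem star_eq_of_nonneg (η : RhoMod κ) {τ σ : Node.{u}} (hd : σ.dom = τ.dom)
    (h : ∀ β < τ.dom, (σ.val β : ℤ) = τ.val β + η.step β) : η.star τ = σ := by
  have hnn : ∀ β < τ.dom, 0 ≤ η.val (η.pred β) + (τ.val β : ℤ) := fun β hβ => by
    have := h β hβ
    rw [step] at this
    omega
  rw [star, if_pos hnn]
  refine Node.ext hd.symm (funext fun β => ?_)
  by_cases hβ : β < τ.dom
  · have := h β hβ
    rw [step] at this
    simp only [Node.ofFun, hβ, if_true]
    omega
  · simp only [Node.ofFun, hβ, if_false]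
    exact (σ.val_eq_zero β (hd ▸ not_lt.1 hβ)).symm

theorem star_eq_empty_or (η : RhoMod κ) (τ : Node.{u}) :
    η.star τ = Node.empty ∨ (η.star τ).dom = τ.dom ∧
      ∀ β < τ.dom, ((η.star τ).val β : ℤ) = τ.val β + η.step β := by
  by_cases hnn : ∀ β < τ.dom, 0 ≤ η.val (η.pred β) + (τ.val β : ℤ)
  · right
    rw [star, if_pos hnn]
    refine ⟨rfl, fun β hβ => ?_⟩
    have := hnn β hβ
    simp only [Node.ofFun, hβ, if_true, step]
    omega
  · left
    rw [star, if_neg hnn]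

/-- There are at most `|δ|` modifications with domain below an infinite ordinal `δ`, and only
countably many if `δ` is finite. -/
theorem mk_dom_subset_le {δ : Ordinal.{u}} :
    Cardinal.mk {η : RhoMod κ // ∀ d ∈ η.dom, d < δ} ≤
      max (Cardinal.mk (Iio δ)) Cardinal.aleph0 := by
  classical
  rcases eq_or_ne δ 0 with rfl | hδ
  · have : IsEmpty {η : RhoMod κ // ∀ d ∈ η.dom, d < 0} :=
      ⟨fun η => (η.2 0 η.1.zero_mem).ne rfl⟩
    rw [Cardinal.mk_eq_zero]
    exact bot_le
  have : Nonempty (Iio δ) := ⟨⟨0, pos_iff_ne_zero.2 hδ⟩⟩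
  have hinj : Function.Injective
      (fun η : {η : RhoMod κ // ∀ d ∈ η.dom, d < δ} =>
        η.1.dom.attach.image fun d => ((⟨d.1, η.2 d.1 d.2⟩ : Iio δ), η.1.val d.1)) := by
    intro η θ h
    have hmem : ∀ (ζ : {η : RhoMod κ // ∀ d ∈ η.dom, d < δ}) (d : Iio δ) (c : ℤ),
        (d, c) ∈ (ζ.1.dom.attach.image fun d => ((⟨d.1, ζ.2 d.1 d.2⟩ : Iio δ), ζ.1.val d.1)) ↔
          d.1 ∈ ζ.1.dom ∧ ζ.1.val d.1 = c := by
      intro ζ d c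
      simp only [Finset.mem_image, Finset.mem_attach, true_and, Prod.mk.injEq, Subtype.exists]
      constructor
      · rintro ⟨a, ha, rfl, rfl⟩
        exact ⟨ha, rfl⟩
      · rintro ⟨h1, h2⟩
        exact ⟨d.1, h1, rfl, h2⟩
    have hiff : ∀ (d : Iio δ) (c : ℤ),
        (d.1 ∈ η.1.dom ∧ η.1.val d.1 = c) ↔ (d.1 ∈ θ.1.dom ∧ θ.1.val d.1 = c) := fun d c => by
      rw [← hmem, ← hmem]
      exact Eq.to_iff (congrArg (fun s => (d, c) ∈ s) h)
    have hdom : ∀ d, d ∈ η.1.dom ↔ d ∈ θ.1.dom := fun d =>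
      ⟨fun hd => ((hiff ⟨d, η.2 d hd⟩ _).1 ⟨hd, rfl⟩).1,
        fun hd => ((hiff ⟨d, θ.2 d hd⟩ _).2 ⟨hd, rfl⟩).1⟩
    have hval : η.1.val = θ.1.val := funext fun d => by
      by_cases hd : d ∈ η.1.dom
      · exact ((hiff ⟨d, η.2 d hd⟩ _).1 ⟨hd, rfl⟩).2.symm
      · rw [η.1.val_eq_zero d hd, θ.1.val_eq_zero d (mt (hdom d).2 hd)]
    have hdom' : η.1.dom = θ.1.dom := Finset.ext hdom
    obtain ⟨⟨ηd, ηv, _, _, _⟩, _⟩ := η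
    obtain ⟨⟨θd, θv, _, _, _⟩, _⟩ := θ
    cases hval
    cases hdom'
    rfl
  refine (Cardinal.mk_le_of_injective hinj).trans ?_
  rw [Cardinal.mk_finset_of_infinite, Cardinal.mk_prod, Cardinal.mk_int, Cardinal.lift_aleph0,
    Cardinal.lift_uzero, Cardinal.mul_eq_max_of_aleph0_le_right (Cardinal.mk_ne_zero _) le_rfl]

theorem mk_dom_subset_lt (hunc : Cardinal.aleph0 < κ) {δ : Ordinal.{u}} (hδ : δ < κ.ord) :
    Cardinal.mk {η : RhoMod κ // ∀ d ∈ η.dom, d < δ} < Cardinal.lift.{u + 1} κ :=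
  mk_dom_subset_le.trans_lt (max_lt (mk_Iio_lt_lift hδ) (aleph0_lt_lift hunc))

theorem mk_le (hunc : Cardinal.aleph0 < κ) :
    Cardinal.mk (RhoMod κ) ≤ Cardinal.mk (Iio κ.ord) := by
  have e : RhoMod κ ≃ {η : RhoMod κ // ∀ d ∈ η.dom, d < κ.ord} :=
    (Equiv.subtypeUnivEquiv fun η d hd => (mem_nacc_Iio_iff.1 (η.dom_subset d hd)).1).symm
  rw [Cardinal.mk_congr e]
  refine mk_dom_subset_le.trans (max_le le_rfl ?_)
  rw [Cardinal.mk_Iio_ordinal, Cardinal.card_ord]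
  exact (aleph0_lt_lift hunc).le

end RhoMod

/-! ### The recursive construction -/

section Construction

/-- A rule for extending nodes: `E β f b δ s` is an extension to length `β` of the sequence `s` of
length `δ`, where `f` is the sequence of length `β` prescribed by the construction and `b` lists
the shorter prescribed sequences. -/
abbrev ExtensionRule : Type (u + 1) :=
  Ordinal.{u} → (Ordinal.{u} → ℕ) → (Ordinal.{u} → Ordinal.{u} → ℕ) → Ordinal.{u} →
    (Ordinal.{u} → ℕ) → Ordinal.{u} → ℕ

/-- The values computed at an ordinal `β`: the prescribed sequence of length `β`, and for each set
`D` of ordinals the sequence of length `β` reached by climbing along `D`. -/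
abbrev Stage : Type (u + 1) :=
  (Ordinal.{u} → ℕ) × (Set Ordinal.{u} → Ordinal.{u} → ℕ)

variable (C : Ordinal.{u} → Set Ordinal.{u}) (E : ExtensionRule.{u})

open Classical in
/-- The prescribed sequence of length `β`, given the stages `w` below `β`: at a successor, `0` is
appended; at a limit, it is the union of the sequences reached by climbing along `C β`, read off at
`ξ` from the first of them that is long enough. The value for `β = 0` is irrelevant. -/
noncomputable def nextSeq (β : Ordinal.{u}) (w : Ordinal.{u} → Stage.{u}) (ξ : Ordinal.{u}) : ℕ :=
  if h : ∃ δ, β = δ + 1 then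
    if ξ < h.choose then (w h.choose).1 ξ else 0
  else (w (sInf (C β \ Iic ξ))).2 (C β) ξ

open Classical in
/-- One step of the recursion. Climbing along `D`, the extension rule is applied at the points that
have a predecessor in `D`; everywhere else the prescribed sequence is taken. -/
noncomputable def nextStage (β : Ordinal.{u}) (w : Ordinal.{u} → Stage.{u}) : Stage.{u} :=
  (nextSeq C β w, fun D =>
    if h : ∃ δ, IsGreatest (D ∩ Iio β) δ then
      E β (nextSeq C β w) (fun α => (w α).1) h.choose ((w h.choose).2 D)
    else nextSeq C β w)

open Classical in
/-- The stages below `β`, with a default value from `β` on. -/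
noncomputable def truncStage (w : Ordinal.{u} → Stage.{u}) (β γ : Ordinal.{u}) : Stage.{u} :=
  if γ < β then w γ else default

open Classical in
/-- The recursion along the ordinals. -/
noncomputable def stage : Ordinal.{u} → Stage.{u} :=
  WellFoundedLT.fix fun β ih => nextStage C E β fun γ => if h : γ < β then ih γ h else default

theorem stage_eq (β : Ordinal.{u}) :
    stage C E β = nextStage C E β (truncStage (stage C E) β) := by
  rw [stage, WellFoundedLT.fix_eq]
  rfl

/-- The prescribed sequence of length `β`. -/
noncomputable def seq (β : Ordinal.{u}) : Ordinal.{u} → ℕ := (stage C E β).1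

/-- The sequence of length `β` reached by climbing along `D`. -/
noncomputable def climb (β : Ordinal.{u}) (D : Set Ordinal.{u}) : Ordinal.{u} → ℕ :=
  (stage C E β).2 D

/-- The prescribed sequences of length below `β`. -/
noncomputable def seqBelow (β α : Ordinal.{u}) : Ordinal.{u} → ℕ :=
  (truncStage (stage C E) β α).1

variable {C E}

theorem seqBelow_of_lt {α β : Ordinal.{u}} (h : α < β) : seqBelow C E β α = seq C E α := by
  rw [seqBelow, truncStage, if_pos h, seq]

theorem seq_eq (β : Ordinal.{u}) : seq C E β = nextSeq C β (truncStage (stage C E) β) := by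
  rw [seq, stage_eq]
  rfl

theorem seq_add_one (δ ξ : Ordinal.{u}) :
    seq C E (δ + 1) ξ = if ξ < δ then seq C E δ ξ else 0 := by
  have h : ∃ δ', δ + 1 = δ' + 1 := ⟨δ, rfl⟩
  have hc : h.choose = δ := (add_one_inj.1 h.choose_spec).symm
  rw [seq_eq, nextSeq, dif_pos h, hc, truncStage, if_pos (lt_add_one δ), seq]

theorem seq_limit {β ξ : Ordinal.{u}} (hβ : IsSuccLimit β) (h : sInf (C β \ Iic ξ) < β) :
    seq C E β ξ = climb C E (sInf (C β \ Iic ξ)) (C β) ξ := by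
  have hn : ¬ ∃ δ, β = δ + 1 := by
    rintro ⟨δ, rfl⟩
    exact not_isSuccLimit_add_one δ hβ
  rw [seq_eq, nextSeq, dif_neg hn, truncStage, if_pos h, climb]

theorem climb_of_isGreatest {β δ : Ordinal.{u}} {D : Set Ordinal.{u}}
    (h : IsGreatest (D ∩ Iio β) δ) :
    climb C E β D = E β (seq C E β) (seqBelow C E β) δ (climb C E δ D) := by
  have h' : ∃ δ, IsGreatest (D ∩ Iio β) δ := ⟨δ, h⟩
  have hc : h'.choose = δ := h'.choose_spec.unique h
  have e : climb C E β D = (nextStage C E β (truncStage (stage C E) β)).2 D := by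
    rw [climb, stage_eq]
  rw [e, nextStage, ← seq_eq]
  dsimp only
  rw [dif_pos h', hc]
  have : truncStage (stage C E) β δ = stage C E δ := if_pos h.1.2
  rw [this]
  rfl

theorem climb_of_not_isGreatest {β : Ordinal.{u}} {D : Set Ordinal.{u}}
    (h : ¬ ∃ δ, IsGreatest (D ∩ Iio β) δ) : climb C E β D = seq C E β := by
  have e : climb C E β D = (nextStage C E β (truncStage (stage C E) β)).2 D := by
    rw [climb, stage_eq]
  rw [e, nextStage, ← seq_eq]
  exact dif_neg h

/-- Climbing to `β` only depends on the part of the set below `β`. -/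
theorem climb_congr (β : Ordinal.{u}) {D D' : Set Ordinal.{u}} (h : D ∩ Iio β = D' ∩ Iio β) :
    climb C E β D = climb C E β D' := by
  induction β using WellFoundedLT.induction with
  | ind β ih =>
    by_cases hg : ∃ δ, IsGreatest (D ∩ Iio β) δ
    · obtain ⟨δ, hδ⟩ := hg
      have hsub : Iio δ ⊆ Iio β := Iio_subset_Iio hδ.1.2.le
      have hδ' : IsGreatest (D' ∩ Iio β) δ := h ▸ hδ
      rw [climb_of_isGreatest hδ, climb_of_isGreatest hδ', ih δ hδ.1.2]
      rw [← inter_eq_self_of_subset_right hsub, ← inter_assoc, ← inter_assoc, h]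
    · rw [climb_of_not_isGreatest hg, climb_of_not_isGreatest (h ▸ hg)]

/-- The part of a proxy sequence used in the construction: the `C α` are clubs and cohere. -/
structure IsCoherentClubSeq (κ : Cardinal.{u}) (C : Ordinal.{u} → Set Ordinal.{u}) : Prop where
  lt : ∀ α < κ.ord, IsSuccLimit α → ∀ β ∈ C α, β < α
  unbounded : ∀ α < κ.ord, IsSuccLimit α → ∀ γ < α, ∃ β ∈ C α, γ ≤ β
  closed : ∀ α < κ.ord, IsSuccLimit α → ∀ S ⊆ C α, S.Nonempty → ∀ β < α, IsLUB S β → β ∈ C α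
  coherent : ∀ α < κ.ord, ∀ β ∈ acc (C α), C β = C α ∩ Iio β

theorem IsProxySequence.isCoherentClubSeq {ξ : Ordinal.{u}} {κ : Cardinal.{u}}
    (h : IsProxySequence ξ κ C) : IsCoherentClubSeq κ C where
  lt α hα hl β hβ := (h.club α (mem_acc_Iio_iff.2 ⟨hα, hl⟩)).1.1 hβ
  unbounded α hα hl γ hγ := by
    obtain ⟨β, hβ, hle⟩ := (h.club α (mem_acc_Iio_iff.2 ⟨hα, hl⟩)).1.2.isCofinal ⟨γ, hγ⟩
    exact ⟨β, hβ, hle⟩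
  closed α hα hl S hS hne β hβ hlub := by
    have hc := (h.club α (mem_acc_Iio_iff.2 ⟨hα, hl⟩)).1
    refine hc.2.isLUB_mem (t := {x : Iio α | x.1 ∈ S}) (x := ⟨β, hβ⟩) (fun x hx => hS hx) ?_ ?_
    · obtain ⟨s, hs⟩ := hne
      exact ⟨⟨s, hc.1 (hS hs)⟩, hs⟩
    · exact ⟨fun x hx => hlub.1 hx, fun x hx => hlub.2 fun s hs => hx (a := ⟨s, hc.1 (hS hs)⟩) hs⟩
  coherent := h.coherent

variable {κ : Cardinal.{u}}

theorem IsCoherentClubSeq.isGreatest_or_mem_acc (hC : IsCoherentClubSeq κ C) {α β : Ordinal.{u}}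
    (hα : α < κ.ord) (hl : IsSuccLimit α) (hβ : β ∈ C α) (hne : (C α ∩ Iio β).Nonempty) :
    (∃ δ, IsGreatest (C α ∩ Iio β) δ) ∨ β ∈ acc (C α) := by
  have hlub : IsLUB (C α ∩ Iio β) (sSup (C α ∩ Iio β)) :=
    isLUB_csSup hne ⟨β, fun x hx => hx.2.le⟩
  have hle : sSup (C α ∩ Iio β) ≤ β := hlub.2 fun x hx => hx.2.le
  rcases hle.lt_or_eq with h | h
  · exact .inl ⟨_, ⟨hC.closed α hα hl _ inter_subset_left hne _
      (h.trans (hC.lt α hα hl β hβ)) hlub, h⟩, hlub.1⟩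
  · rw [h] at hlub
    obtain ⟨x, hx⟩ := hne
    exact .inr ⟨hβ, hlub, (zero_le (a := x)).trans_lt hx.2⟩

/-- If the sequences found while climbing along `C α` extend each other, then the prescribed
sequence of length `α` is their union. -/
theorem seq_eq_climb {α : Ordinal.{u}} (hl : IsSuccLimit α) (hlt : ∀ β ∈ C α, β < α)
    (h : ∀ β ∈ C α, ∀ δ ∈ C α, δ < β → ∀ ξ < δ, climb C E β (C α) ξ = climb C E δ (C α) ξ)
    {β ξ : Ordinal.{u}} (hβ : β ∈ C α) (hξ : ξ < β) :
    seq C E α ξ = climb C E β (C α) ξ := by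
  have hmem : β ∈ C α \ Iic ξ := ⟨hβ, not_le.2 hξ⟩
  have hle : sInf (C α \ Iic ξ) ≤ β := csInf_le' hmem
  have hin : sInf (C α \ Iic ξ) ∈ C α \ Iic ξ := csInf_mem ⟨β, hmem⟩
  rw [seq_limit hl (hle.trans_lt (hlt β hβ))]
  rcases hle.lt_or_eq with h1 | h1
  · exact (h β hβ _ hin.1 h1 ξ (not_le.1 hin.2)).symm
  · rw [h1]

variable (C E) in
/-- The inductive hypothesis of the construction at `α`: coherence with the shorter prescribed
sequences, and zeros at cofinally many places if `α` is a limit. -/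
def IsGoodAt (α : Ordinal.{u}) : Prop :=
  (∀ β < α, Coh β (seq C E α) (seq C E β)) ∧
    (IsSuccLimit α → ∀ γ < α, ∃ ξ, γ ≤ ξ ∧ ξ < α ∧ seq C E α ξ = 0)

theorem isLscAtLimits_seq {α : Ordinal.{u}} (h : ∀ β ≤ α, IsGoodAt C E β) :
    IsLscAtLimits α (seq C E α) := by
  intro δ hδ hl
  have hle : δ + 1 ≤ α := add_one_le_iff.2 hδ
  have hcoh : Coh (δ + 1) (seq C E α) (seq C E (δ + 1)) := by
    rcases hle.eq_or_lt with e | e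
    · rw [e]; exact .refl _ _
    · exact (h α le_rfl).1 _ e
  refine hcoh.exists_le_at_limit hl fun γ hγ => ?_
  obtain ⟨ξ, h1, h2, h3⟩ := (h δ hδ.le).2 hl γ hγ
  refine ⟨ξ, h1, h2, ?_⟩
  rw [seq_add_one, if_pos h2, h3]
  exact Nat.zero_le _

/-- The extension rule yields admissible extensions whenever there are any. -/
def ExtensionRule.IsSound (E : ExtensionRule.{u}) : Prop :=
  ∀ β f b δ s, (∃ t, IsAdmissible β f δ s t) → IsAdmissible β f δ s (E β f b δ s)

theorem climb_isAdmissible (hE : E.IsSound) {β δ : Ordinal.{u}} {D : Set Ordinal.{u}}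
    (hgood : ∀ γ ≤ β, IsGoodAt C E γ) (hδ : IsGreatest (D ∩ Iio β) δ)
    (h : Coh δ (climb C E δ D) (seq C E δ)) :
    IsAdmissible β (seq C E β) δ (climb C E δ D) (climb C E β D) := by
  rw [climb_of_isGreatest hδ]
  refine hE _ _ _ _ _ (exists_isAdmissible (isLscAtLimits_seq hgood) hδ.1.2 ?_)
  exact h.trans ((hgood β le_rfl).1 δ hδ.1.2).symm

theorem climb_coherent (hC : IsCoherentClubSeq κ C) (hE : E.IsSound) {α : Ordinal.{u}}
    (hα : α < κ.ord) (hl : IsSuccLimit α) (hgood : ∀ β < α, IsGoodAt C E β)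
    (β : Ordinal.{u}) (hβ : β ∈ C α) :
    Coh β (climb C E β (C α)) (seq C E β) ∧
      ∀ δ ∈ C α, δ < β → ∀ ξ < δ, climb C E β (C α) ξ = climb C E δ (C α) ξ := by
  induction β using WellFoundedLT.induction with
  | ind β ih =>
    have hβα := hC.lt α hα hl β hβ
    by_cases hg : ∃ δ, IsGreatest (C α ∩ Iio β) δ
    · obtain ⟨δ, hδ⟩ := hg
      obtain ⟨ih1, ih2⟩ := ih δ hδ.1.2 hδ.1.1
      obtain ⟨h1, h2, -⟩ :=
        climb_isAdmissible hE (fun γ hγ => hgood γ (hγ.trans_lt hβα)) hδ ih1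
      refine ⟨h1, fun δ' hδ' hlt ξ hξ => ?_⟩
      have hle : δ' ≤ δ := hδ.2 ⟨hδ', hlt⟩
      rw [h2 ξ (hξ.trans_le hle)]
      rcases hle.lt_or_eq with h | rfl
      · exact ih2 δ' hδ' h ξ hξ
      · rfl
    · rw [climb_of_not_isGreatest hg]
      refine ⟨.refl _ _, fun δ hδ hlt ξ hξ => ?_⟩
      have hacc : β ∈ acc (C α) :=
        (hC.isGreatest_or_mem_acc hα hl hβ ⟨δ, hδ, hlt⟩).resolve_left hg
      have hCβ := hC.coherent α hα β hacc
      have hcongr : ∀ γ < β, climb C E γ (C β) = climb C E γ (C α) := fun γ hγ => by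
        refine climb_congr γ ?_
        rw [hCβ, inter_assoc, inter_eq_self_of_subset_right (Iio_subset_Iio hγ.le)]
      have hsub : ∀ γ, γ ∈ C β ↔ γ ∈ C α ∧ γ < β := fun γ => by rw [hCβ]; rfl
      rw [← hcongr δ hlt]
      refine seq_eq_climb (isSuccLimit_of_mem_acc hacc) (fun γ hγ => ((hsub γ).1 hγ).2) ?_
        ((hsub δ).2 ⟨hδ, hlt⟩) hξ
      intro γ hγ δ' hδ' hlt' ζ hζ
      rw [hsub] at hγ hδ'
      rw [hcongr γ hγ.2, hcongr δ' hδ'.2]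
      exact (ih γ hγ.2 hγ.1).2 δ' hδ'.1 hlt' ζ hζ

theorem seq_eq_climb_of_good (hC : IsCoherentClubSeq κ C) (hE : E.IsSound) {α : Ordinal.{u}}
    (hα : α < κ.ord) (hl : IsSuccLimit α) (hgood : ∀ β < α, IsGoodAt C E β)
    {β ξ : Ordinal.{u}} (hβ : β ∈ C α) (hξ : ξ < β) :
    seq C E α ξ = climb C E β (C α) ξ :=
  seq_eq_climb hl (hC.lt α hα hl) (fun β hβ => (climb_coherent hC hE hα hl hgood β hβ).2) hβ hξ

theorem isGoodAt_limit (hC : IsCoherentClubSeq κ C) (hE : E.IsSound) {α : Ordinal.{u}}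
    (hα : α < κ.ord) (hl : IsSuccLimit α) (hgood : ∀ β < α, IsGoodAt C E β) :
    IsGoodAt C E α := by
  refine ⟨fun β hβ => ?_, fun _ γ hγ => ?_⟩
  · obtain ⟨γ, hγ, hle⟩ := hC.unbounded α hα hl β hβ
    have hγα := hC.lt α hα hl γ hγ
    have h1 : Coh γ (seq C E α) (climb C E γ (C α)) :=
      .of_eq fun ξ hξ => seq_eq_climb_of_good hC hE hα hl hgood hγ hξ
    have h2 : Coh β (seq C E α) (seq C E γ) :=
      (h1.trans (climb_coherent hC hE hα hl hgood γ hγ).1).mono hle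
    rcases hle.lt_or_eq with h | rfl
    · exact h2.trans ((hgood γ hγα).1 β h)
    · exact h2
  · -- Each point of `C α` has a next point, since `C α` is unbounded in the limit `α`.
    have hnext : ∀ δ ∈ C α, ∃ β ∈ C α, IsGreatest (C α ∩ Iio β) δ := fun δ hδ => by
      obtain ⟨γ, hγ, hle⟩ := hC.unbounded α hα hl (δ + 1) (hl.succ_lt (hC.lt α hα hl δ hδ))
      have hne : (C α \ Iic δ).Nonempty := ⟨γ, hγ, not_le.2 (add_one_le_iff.1 hle)⟩
      have hin := csInf_mem hne
      have hlt : δ < sInf (C α \ Iic δ) := not_le.1 hin.2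
      refine ⟨sInf (C α \ Iic δ), hin.1, ⟨hδ, hlt⟩, fun ξ hξ => ?_⟩
      by_contra hξδ
      have hmem : ξ ∈ C α \ Iic δ := ⟨hξ.1, hξδ⟩
      exact (csInf_le' hmem).not_gt hξ.2
    -- A step along `C α` yields a zero, unless it passes from a limit to its successor.
    have hzero : ∀ δ β, β ∈ C α → IsGreatest (C α ∩ Iio β) δ →
        (∃ ξ, δ ≤ ξ ∧ ξ < β ∧ seq C E α ξ = 0) ∨ β = δ + 1 ∧ IsSuccLimit δ := by
      intro δ β hβ hδ
      have hβα := hC.lt α hα hl β hβ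
      have h := (climb_isAdmissible hE (fun γ hγ => hgood γ (hγ.trans_lt hβα)) hδ
        (climb_coherent hC hE hα hl hgood δ hδ.1.1).1).2.2
      refine h.imp_left ?_
      rintro ⟨ξ, h1, h2, h3⟩
      exact ⟨ξ, h1, h2, (seq_eq_climb_of_good hC hE hα hl hgood hβ h2).trans h3⟩
    obtain ⟨δ, hδ, hγδ⟩ := hC.unbounded α hα hl γ hγ
    obtain ⟨β, hβ, hδβ⟩ := hnext δ hδ
    obtain ⟨β', hβ', hββ'⟩ := hnext β hβ
    rcases hzero δ β hβ hδβ with ⟨ξ, h1, h2, h3⟩ | ⟨rfl, -⟩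
    · exact ⟨ξ, hγδ.trans h1, h2.trans (hC.lt α hα hl β hβ), h3⟩
    · rcases hzero _ β' hβ' hββ' with ⟨ξ, h1, h2, h3⟩ | ⟨-, h⟩
      · exact ⟨ξ, hγδ.trans ((lt_add_one δ).le.trans h1), h2.trans (hC.lt α hα hl β' hβ'), h3⟩
      · exact absurd h (not_isSuccLimit_add_one δ)

theorem isGoodAt (hC : IsCoherentClubSeq κ C) (hE : E.IsSound) {α : Ordinal.{u}}
    (hα : α < κ.ord) : IsGoodAt C E α := by
  induction α using WellFoundedLT.induction with
  | ind α ih =>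
    by_cases hl : IsSuccLimit α
    · exact isGoodAt_limit hC hE hα hl fun β hβ => ih β hβ (hβ.trans hα)
    refine ⟨fun β hβ => ?_, fun h => absurd h hl⟩
    obtain ⟨δ, rfl⟩ : ∃ δ, α = δ + 1 := by
      rcases Ordinal.zero_or_succ_or_isSuccLimit α with rfl | ⟨δ, rfl⟩ | h
      · exact absurd hβ not_lt_bot
      · exact ⟨δ, rfl⟩
      · exact absurd h hl
    have hle : β ≤ δ := lt_add_one_iff.1 hβ
    have h1 : Coh δ (seq C E (δ + 1)) (seq C E δ) :=
      .of_eq fun ξ hξ => by rw [seq_add_one, if_pos hξ]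
    rcases hle.lt_or_eq with h | rfl
    · exact (h1.mono hle).trans ((ih δ (lt_add_one δ) ((lt_add_one δ).trans hα)).1 β h)
    · exact h1

theorem coh_seq (hC : IsCoherentClubSeq κ C) (hE : E.IsSound) {α β : Ordinal.{u}}
    (hα : α < κ.ord) (hβ : β ≤ α) : Coh β (seq C E α) (seq C E β) := by
  rcases hβ.lt_or_eq with h | rfl
  · exact (isGoodAt hC hE hα).1 β h
  · exact .refl _ _

theorem isLscAtLimits_seq_of_lt (hC : IsCoherentClubSeq κ C) (hE : E.IsSound) {α : Ordinal.{u}}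
    (hα : α < κ.ord) : IsLscAtLimits α (seq C E α) :=
  isLscAtLimits_seq fun _ hβ => isGoodAt hC hE (hβ.trans_lt hα)

/-- The prescribed sequence of a limit length `α` passes through values of the extension rule at
the points of `C α` that have a predecessor in `C α`. -/
theorem seq_eq_extension (hC : IsCoherentClubSeq κ C) (hE : E.IsSound) {α : Ordinal.{u}}
    (hα : α < κ.ord) (hl : IsSuccLimit α) {β δ : Ordinal.{u}} (hβ : β ∈ C α)
    (hδ : IsGreatest (C α ∩ Iio β) δ) :
    ∃ s, (∀ ξ < δ, s ξ = seq C E α ξ) ∧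
      ∀ ξ < β, seq C E α ξ = E β (seq C E β) (seqBelow C E β) δ s ξ := by
  have hgood : ∀ β < α, IsGoodAt C E β := fun β h => isGoodAt hC hE (h.trans hα)
  refine ⟨climb C E δ (C α),
    fun ξ hξ => (seq_eq_climb_of_good hC hE hα hl hgood hδ.1.1 hξ).symm, fun ξ hξ => ?_⟩
  rw [seq_eq_climb_of_good hC hE hα hl hgood hβ hξ, climb_of_isGreatest hδ]

end Construction

/-! ### The tree generated by a coherent sequence -/

section Tree

variable {κ : Cardinal.{u}}

/-- `b` assigns to each `α < κ` a sequence of length `α` such that these sequences cohere and do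
not jump down at limits. -/
structure IsCoherentSeq (κ : Cardinal.{u}) (b : Ordinal.{u} → Ordinal.{u} → ℕ) : Prop where
  coh : ∀ α < κ.ord, ∀ β ≤ α, Coh β (b α) (b β)
  lsc : ∀ α < κ.ord, IsLscAtLimits α (b α)

/-- The tree of all nodes that are coherent with the member of `b` of the same length. -/
def treeOf (κ : Cardinal.{u}) (b : Ordinal.{u} → Ordinal.{u} → ℕ) : Set Node.{u} :=
  {t | t.dom < κ.ord ∧ Coh t.dom t.val (b t.dom)}

variable {b : Ordinal.{u} → Ordinal.{u} → ℕ}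

theorem Node.ofFun_val {α ξ : Ordinal.{u}} (f : Ordinal.{u} → ℕ) (h : ξ < α) :
    (Node.ofFun α f).val ξ = f ξ :=
  if_pos h

theorem ofFun_mem_treeOf {α : Ordinal.{u}} {f : Ordinal.{u} → ℕ} (hα : α < κ.ord)
    (hf : Coh α f (b α)) : Node.ofFun α f ∈ treeOf κ b :=
  ⟨hα, (Coh.of_eq fun _ h => Node.ofFun_val f h).trans hf⟩

theorem Node.restrict_le (t : Node.{u}) (α : Ordinal.{u}) : t.restrict α ≤ t :=
  ⟨min_le_left _ _, fun _ h => Node.ofFun_val _ h⟩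

theorem Node.ext_of_lt {s t : Node.{u}} (hd : s.dom = t.dom) (h : ∀ ξ < s.dom, s.val ξ = t.val ξ) :
    s = t := by
  have h1 : s ≤ t := ⟨hd.le, h⟩
  have h2 : t ≤ s := ⟨hd.ge, fun ξ hξ => (h ξ (hd ▸ hξ)).symm⟩
  exact le_antisymm h1 h2

theorem IsCoherentSeq.restrict_mem (hb : IsCoherentSeq κ b) {t : Node.{u}} (ht : t ∈ treeOf κ b)
    (α : Ordinal.{u}) : t.restrict α ∈ treeOf κ b := by
  have hle : min t.dom α ≤ t.dom := min_le_left _ _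
  exact ofFun_mem_treeOf (hle.trans_lt ht.1) ((ht.2.mono hle).trans (hb.coh _ ht.1 _ hle))

theorem IsCoherentSeq.isStreamlinedTree (hb : IsCoherentSeq κ b) (hreg : κ.IsRegular)
    (hunc : Cardinal.aleph0 < κ) : IsStreamlinedTree κ (treeOf κ b) where
  dom_lt t ht := ht.1
  restrict_mem t ht α _ := hb.restrict_mem ht α
  level_nonempty α hα := ⟨_, ofFun_mem_treeOf hα (.refl _ _), rfl⟩
  level_small α hα := by
    have hκ : 0 < κ.ord := (zero_le (a := α)).trans_lt hα
    have h : ∀ t : level (treeOf κ b) α, ∃ η : {η : RhoMod κ // ∀ d ∈ η.dom, d < α + 1},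
        ∀ ξ < α, (t.1.val ξ : ℤ) = b α ξ + η.1.step ξ := by
      rintro ⟨t, ⟨hκ', g, hg, e⟩, rfl⟩
      obtain ⟨η, h1, h2⟩ := RhoMod.exists_step_eq hκ hg hα.le
      refine ⟨⟨η, fun d hd => ?_⟩, fun ξ hξ => by rw [e ξ hξ, h2 ξ hξ]⟩
      rcases h1 d hd with h | rfl
      · exact h.trans (lt_add_one _)
      · exact (zero_le (a := t.dom)).trans_lt (lt_add_one _)
    choose F hF using h
    refine (Cardinal.mk_le_of_injective (f := F) fun t t' htt' => Subtype.ext ?_).trans_lt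
      (RhoMod.mk_dom_subset_lt hunc (add_one_lt_ord hreg.aleph0_le hα))
    refine Node.ext_of_lt (t.2.2.trans t'.2.2.symm) fun ξ hξ => ?_
    rw [t.2.2] at hξ
    have e := (hF t ξ hξ).trans (htt' ▸ (hF t' ξ hξ).symm)
    exact_mod_cast e

theorem treeOf_isUniformlyRhoCoherent (hκ : 0 < κ.ord) :
    IsUniformlyRhoCoherent κ (treeOf κ b) := by
  constructor
  · rintro α hα t ⟨ht, rfl⟩ s ⟨hs, hd⟩
    obtain ⟨g, hg, e⟩ := (hd ▸ hs.2 : Coh t.dom s.val (b t.dom)).trans ht.2.symm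
    obtain ⟨η, -, h⟩ := RhoMod.exists_step_eq hκ hg hα.le
    exact ⟨η, η.star_eq_of_nonneg hd fun β hβ => by rw [e β hβ, h β hβ]⟩
  · intro t ht η
    rcases η.star_eq_empty_or t with h | ⟨hd, h⟩
    · rw [h]
      exact ofFun_mem_treeOf hκ ⟨_, .const 0, fun ξ hξ => absurd hξ not_lt_bot⟩
    · refine ⟨hd ▸ ht.1, ?_⟩
      rw [hd]
      exact Coh.trans ⟨_, η.isStep_step, h⟩ ht.2

open Classical in
/-- The nodes that are positive below `γ + 1` and `0` at their last place `γ + 1` form an antichain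
of size `κ`. As `γ + 1` is not a limit, the value there may be chosen freely. -/
theorem treeOf_not_isSouslinTree (hκ : Cardinal.aleph0 ≤ κ) :
    ¬ IsSouslinTree κ (treeOf κ b) := by
  rintro ⟨-, hno⟩
  let f : Ordinal.{u} → Ordinal.{u} → ℕ := fun γ =>
    Function.update (fun ξ => b (γ + 1 + 1) ξ + 1) (γ + 1) 0
  let t : Ordinal.{u} → Node.{u} := fun γ => Node.ofFun (γ + 1 + 1) (f γ)
  have hinj : Function.Injective t := fun γ γ' h => by
    have : γ + 1 + 1 = γ' + 1 + 1 := congrArg Node.dom h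
    simpa using this
  refine hno ⟨t '' Iio κ.ord, ?_, ?_, ?_⟩
  · rintro _ ⟨γ, hγ, rfl⟩
    refine ofFun_mem_treeOf (add_one_lt_ord hκ (add_one_lt_ord hκ hγ)) ?_
    refine (Coh.update _ _ (not_isSuccLimit_add_one γ) 0).trans ?_
    exact ⟨_, .const 1, fun ξ _ => by push_cast; rfl⟩
  · rintro _ ⟨γ, hγ, rfl⟩ _ ⟨γ', hγ', rfl⟩ hne hle
    have hle' : γ + 1 + 1 ≤ γ' + 1 + 1 := hle.1
    have hlt : γ < γ' := by
      refine lt_of_le_of_ne (by simpa using hle') fun h => hne (by rw [h])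
    have hlast : γ + 1 < γ + 1 + 1 := lt_add_one _
    have e := hle.2 (γ + 1) hlast
    rw [Node.ofFun_val _ hlast, Node.ofFun_val _ (hlast.trans_le hle')] at e
    have hne' : γ + 1 ≠ γ' + 1 := by simpa using hlt.ne
    simp [f, Function.update_of_ne hne'] at e
  · rw [Cardinal.mk_image_eq hinj, Cardinal.mk_Iio_ordinal, Cardinal.card_ord]

theorem height_eq {A : Set Node.{u}} (h : ∀ α < κ.ord, (level A α).Nonempty)
    (hA : ∀ t ∈ A, t.dom < κ.ord) : height A = κ.ord := by
  refine le_antisymm (csInf_le' ?_) (le_csInf ⟨κ.ord, ?_⟩ fun α hα => ?_)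
  · exact eq_empty_of_forall_notMem fun t ht => (hA t ht.1).ne ht.2
  · exact eq_empty_of_forall_notMem fun t ht => (hA t ht.1).ne ht.2
  · by_contra hlt
    exact (h α (not_le.1 hlt)).ne_empty hα

theorem IsSubtree.level_nonempty {T A : Set Node.{u}} (hT : IsStreamlinedTree κ T)
    (hA : IsSubtree T A) {α : Ordinal.{u}} (hα : α < κ.ord) : (level A α).Nonempty := by
  rw [← height_eq hT.level_nonempty hT.dom_lt, ← hA.2.2] at hα
  have h : α ∉ {α | level A α = ∅} := notMem_of_lt_csInf' hα
  exact nonempty_iff_ne_empty.2 h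

theorem IsSubtree.mem_of_le {T A : Set Node.{u}} (hA : IsSubtree T A) {s t : Node.{u}}
    (hs : s ∈ T) (ht : t ∈ A) (hst : s ≤ t) : s ∈ A := by
  rw [← hA.2.1]
  exact ⟨hs, t, ht, hst⟩

/-- The downward closure of a chain of size `κ` is a subtree. -/
theorem isSubtree_downClosure {T B : Set Node.{u}} (hT : IsStreamlinedTree κ T) (hBT : B ⊆ T)
    (hB : IsChain (· ≤ ·) B) (hcard : Cardinal.mk B = Cardinal.lift.{u + 1} κ) :
    IsSubtree T (downClosure T B) := by
  have hsub : downClosure T B ⊆ T := fun t ht => ht.1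
  refine ⟨hsub, Subset.antisymm (fun s ⟨hs, t, ⟨_, x, hx, htx⟩, hst⟩ => ⟨hs, x, hx, hst.trans htx⟩)
    fun s hs => ⟨hs.1, s, hs, le_rfl⟩, ?_⟩
  rw [height_eq hT.level_nonempty hT.dom_lt]
  refine height_eq (fun α hα => ?_) fun t ht => hT.dom_lt t ht.1
  obtain ⟨x, hx, hαx⟩ : ∃ x ∈ B, α ≤ x.dom := by
    by_contra! h
    -- Members of a chain are determined by their length.
    have hinj : Function.Injective fun x : B => (⟨x.1.dom, h x.1 x.2⟩ : Iio α) := by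
      intro x y hxy
      have hd : x.1.dom = y.1.dom := congrArg Subtype.val hxy
      rcases hB.total x.2 y.2 with hle | hle
      · exact Subtype.ext (Node.ext_of_lt hd hle.2)
      · exact Subtype.ext (Node.ext_of_lt hd.symm hle.2).symm
    exact ((Cardinal.mk_le_of_injective hinj).trans_lt (mk_Iio_lt_lift hα)).ne hcard
  exact ⟨x.restrict α, ⟨hT.restrict_mem x (hBT hx) α hα, x, hx, x.restrict_le α⟩,
    min_eq_right hαx⟩

open Classical in
/-- A frozen cone at a non-limit level of the tree contains two incompatible nodes, so a tree all
of whose subtrees contain a frozen cone has no chain of size `κ`. -/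
theorem IsCoherentSeq.isAronszajnTree (hb : IsCoherentSeq κ b) (hreg : κ.IsRegular)
    (hunc : Cardinal.aleph0 < κ)
    (hcone : ∀ A, IsSubtree (treeOf κ b) A → ∃ s ∈ treeOf κ b, s.dom ∈ nacc (Iio κ.ord) ∧
      ∃ i : ℕ, frozenCone (treeOf κ b) s i ⊆ A) :
    IsAronszajnTree κ (treeOf κ b) := by
  have hT := hb.isStreamlinedTree hreg hunc
  refine ⟨hT, ?_⟩
  rintro ⟨B, hBT, hB, hcard⟩
  obtain ⟨s, hs, hdom, i, hi⟩ := hcone _ (isSubtree_downClosure hT hBT hB hcard)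
  -- The one-place extensions of `s` by `i` and by `i + 1` both lie in the frozen cone.
  have hmem : ∀ n, i ≤ n → Node.ofFun (s.dom + 1) (Function.update s.val s.dom n) ∈
      downClosure (treeOf κ b) B := by
    intro n hn
    have hlt := add_one_lt_ord hreg.aleph0_le hs.1
    have hnl := (mem_nacc_Iio_iff.1 hdom).2
    refine hi ⟨ofFun_mem_treeOf hlt ?_, .inr ⟨⟨(lt_add_one _).le, fun ξ hξ => ?_⟩, ?_⟩⟩
    · refine (Coh.update _ _ hnl n).trans ?_
      obtain ⟨t, ht, hts, -⟩ := exists_extension (hb.lsc _ hlt) (lt_add_one s.dom).le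
        (hs.2.trans (hb.coh _ hlt _ (lt_add_one s.dom).le).symm) 0
      refine Coh.trans ?_ ht
      refine Coh.trans ?_ (Coh.update _ t hnl (s.val s.dom))
      refine .of_eq fun ξ hξ => ?_
      rcases (lt_add_one_iff.1 hξ).lt_or_eq with h | rfl
      · rw [Function.update_of_ne h.ne, hts ξ h]
      · rw [Function.update_self]
    · rw [Node.ofFun_val _ (hξ.trans (lt_add_one _)), Function.update_of_ne hξ.ne]
    · intro ξ h1 h2
      have : ξ = s.dom := le_antisymm (lt_add_one_iff.1 h2) h1
      subst this
      rw [Node.ofFun_val _ (lt_add_one _), Function.update_self]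
      exact hn
  obtain ⟨-, x, hx, hxi⟩ := hmem i le_rfl
  obtain ⟨-, y, hy, hyi⟩ := hmem (i + 1) (Nat.le_succ i)
  have hs' : s.dom < s.dom + 1 := lt_add_one _
  have e1 := hxi.2 s.dom hs'
  have e2 := hyi.2 s.dom hs'
  rw [Node.ofFun_val _ hs', Function.update_self] at e1 e2
  have hx' : s.dom < x.dom := hs'.trans_le hxi.1
  have hy' : s.dom < y.dom := hs'.trans_le hyi.1
  rcases hB.total hx hy with h | h
  · have := h.2 _ hx'
    omega
  · have := h.2 _ hy'
    omega

end Tree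

/-! ### Sealing -/

section Sealing

variable {κ : Cardinal.{u}}

/-- There is an injective coding, by ordinals below `κ`, of triples of two modifications and an
ordinal below `κ`. -/
theorem exists_code (hunc : Cardinal.aleph0 < κ) :
    ∃ c : RhoMod κ → RhoMod κ → Ordinal.{u} → Ordinal.{u},
      (∀ η θ α, α < κ.ord → c η θ α < κ.ord) ∧
      ∀ η θ α η' θ' α', α < κ.ord → α' < κ.ord → c η θ α = c η' θ' α' →
        η = η' ∧ θ = θ' ∧ α = α' := by
  classical
  have hinf : Cardinal.aleph0 ≤ Cardinal.mk (Iio κ.ord) := by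
    rw [Cardinal.mk_Iio_ordinal, Cardinal.card_ord]
    exact (aleph0_lt_lift hunc).le
  have hle : Cardinal.mk (RhoMod κ × RhoMod κ × Iio κ.ord) ≤ Cardinal.mk (Iio κ.ord) := by
    rw [Cardinal.mk_prod, Cardinal.mk_prod]
    simp only [Cardinal.lift_id]
    have h := RhoMod.mk_le hunc
    calc _ ≤ Cardinal.mk (Iio κ.ord) * (Cardinal.mk (Iio κ.ord) * Cardinal.mk (Iio κ.ord)) := by
            gcongr
      _ = _ := by rw [Cardinal.mul_eq_self hinf, Cardinal.mul_eq_self hinf]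
  obtain ⟨e⟩ := Cardinal.le_def _ _ |>.1 hle
  refine ⟨fun η θ α => if h : α < κ.ord then e (η, θ, ⟨α, h⟩) else 0, fun η θ α h => ?_,
    fun η θ α η' θ' α' h h' heq => ?_⟩
  · simp only [h, dif_pos]
    exact (e _).2
  · simp only [h, h', dif_pos] at heq
    have h3 := e.injective (Subtype.ext heq)
    simp only [Prod.mk.injEq] at h3
    exact ⟨h3.1, h3.2.1, congrArg Subtype.val h3.2.2⟩

/-- `t` is sealed at `β`: for some triple `(η, θ, α)` coded by a member of the guess `G` and some
`α < β`, the modification of `t ↾ α` by `η` is the modification of `b α` by `θ`. -/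
def IsSealed (c : RhoMod κ → RhoMod κ → Ordinal.{u} → Ordinal.{u}) (G : Set Ordinal.{u})
    (β : Ordinal.{u}) (b : Ordinal.{u} → Ordinal.{u} → ℕ) (t : Ordinal.{u} → ℕ) : Prop :=
  ∃ η θ : RhoMod κ, ∃ α < β, c η θ α ∈ G ∧
    ∀ ξ < α, (t ξ : ℤ) + η.step ξ = b α ξ + θ.step ξ

open Classical in
/-- The rule that takes an admissible sealed extension if there is one, and any admissible
extension otherwise. -/
noncomputable def sealRule (c : RhoMod κ → RhoMod κ → Ordinal.{u} → Ordinal.{u})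
    (A : Ordinal.{u} → Set Ordinal.{u}) : ExtensionRule.{u} := fun β f b δ s =>
  if h : ∃ t, IsAdmissible β f δ s t ∧ IsSealed c (A β) β b t then h.choose
  else if h : ∃ t, IsAdmissible β f δ s t then h.choose else fun _ => 0

variable {c : RhoMod κ → RhoMod κ → Ordinal.{u} → Ordinal.{u}}

theorem sealRule_isSound (A : Ordinal.{u} → Set Ordinal.{u}) : (sealRule c A).IsSound := by
  intro β f b δ s h
  by_cases h' : ∃ t, IsAdmissible β f δ s t ∧ IsSealed c (A β) β b t
  · rw [sealRule, dif_pos h']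
    exact h'.choose_spec.1
  · rw [sealRule, dif_neg h', dif_pos h]
    exact h.choose_spec

theorem sealRule_isSealed {A : Ordinal.{u} → Set Ordinal.{u}} {β δ : Ordinal.{u}}
    {f s : Ordinal.{u} → ℕ} {b : Ordinal.{u} → Ordinal.{u} → ℕ}
    (h : ∃ t, IsAdmissible β f δ s t ∧ IsSealed c (A β) β b t) :
    IsSealed c (A β) β b (sealRule c A β f b δ s) := by
  rw [sealRule, dif_pos h]
  exact h.choose_spec.2

variable {b : Ordinal.{u} → Ordinal.{u} → ℕ} {A : Set Node.{u}}

/-- The node `u` lies in the tree but not in `A`; it extends the modification by `η` of the sequence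
`s` of length `δ`, and is itself the modification by `η` of a sequence of the tree, and the
modification of the member of `b` by `θ`. -/
structure IsEscape (b : Ordinal.{u} → Ordinal.{u} → ℕ) (A : Set Node.{u}) (η : RhoMod κ)
    (δ : Ordinal.{u}) (s : Ordinal.{u} → ℕ) (θ : RhoMod κ) (t : Ordinal.{u} → ℕ)
    (u : Node.{u}) : Prop where
  mem : u ∈ treeOf κ b
  notMem : u ∉ A
  lt_dom : δ < u.dom
  coh : Coh u.dom t (b u.dom)
  eq_of_lt : ∀ ξ < δ, t ξ = s ξ
  val_eq : ∀ ξ < u.dom, (u.val ξ : ℤ) = t ξ + η.step ξ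
  val_eq' : ∀ ξ < u.dom, (u.val ξ : ℤ) = b u.dom ξ + θ.step ξ

/-- The subtree `A` contains no frozen cone, stated for the tree of `b`. -/
def HasNoFrozenCone (κ : Cardinal.{u}) (b : Ordinal.{u} → Ordinal.{u} → ℕ) (A : Set Node.{u}) :
    Prop :=
  ∀ s ∈ treeOf κ b, s.dom ∈ nacc (Iio κ.ord) → ∀ i : ℕ, ¬ frozenCone (treeOf κ b) s i ⊆ A

/-- If `A` contains no frozen cone, then every sequence `s` whose modification by `η` makes sense
can be extended so that its modification leaves `A`: take `i` at least the last value `e` of `η` and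
leave `A` inside a frozen cone with bound `i`; subtracting `e` keeps the values nonnegative. -/
theorem IsCoherentSeq.exists_isEscape (hb : IsCoherentSeq κ b) (hκ : Cardinal.aleph0 ≤ κ)
    (hA : IsSubtree (treeOf κ b) A) (hno : HasNoFrozenCone κ b A) {η : RhoMod κ}
    {δ : Ordinal.{u}} (hδ : δ < κ.ord) (hη : ∀ d ∈ η.dom, d ≤ δ) {s : Ordinal.{u} → ℕ}
    (hs : Coh δ s (b δ)) (hnn : ∀ ξ < δ, 0 ≤ (s ξ : ℤ) + η.step ξ) :
    ∃ θ t u, IsEscape b A η δ s θ t u := by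
  have hδ1 : δ + 1 < κ.ord := add_one_lt_ord hκ hδ
  have hlt : δ < δ + 1 := lt_add_one δ
  obtain ⟨s₁, hs₁, hs₁s, hs₁N⟩ := exists_extension (hb.lsc _ hδ1) hlt.le
    (hs.trans (hb.coh _ hδ1 _ hlt.le).symm) (-η.step δ).toNat
  have hnn₁ : ∀ ξ < δ + 1, 0 ≤ (s₁ ξ : ℤ) + η.step ξ := by
    intro ξ hξ
    rcases (lt_add_one_iff.1 hξ).lt_or_eq with h | rfl
    · rw [hs₁s ξ h]
      exact hnn ξ h
    by_cases hl : IsSuccLimit ξ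
    · refine ((hb.lsc _ hδ1).congr hs₁).nonneg_at_limit η.isStep_step hlt hl fun ζ hζ => ?_
      rw [hs₁s ζ hζ]
      exact hnn ζ hζ
    · have := hs₁N ξ le_rfl fun _ => hl
      omega
  let r : Node.{u} := Node.ofFun (δ + 1) fun ξ => (s₁ ξ + η.step ξ).toNat
  have hrv : ∀ ξ < δ + 1, (r.val ξ : ℤ) = s₁ ξ + η.step ξ := fun ξ hξ => by
    rw [Node.ofFun_val _ hξ, Int.toNat_of_nonneg (hnn₁ ξ hξ)]
  have hr : r ∈ treeOf κ b := ⟨hδ1, Coh.trans ⟨_, η.isStep_step, hrv⟩ hs₁⟩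
  obtain ⟨u, hu, huA, hru, hui⟩ : ∃ u ∈ treeOf κ b, u ∉ A ∧
      IsExtension (η.step δ).toNat r u := by
    obtain ⟨u, ⟨hu, h⟩, huA⟩ := not_subset.1 (hno r hr
      (mem_nacc_Iio_iff.2 ⟨hδ1, not_isSuccLimit_add_one δ⟩) (η.step δ).toNat)
    rcases h with h | h
    · exact ⟨r, hr, fun hrA => huA (hA.mem_of_le hu hrA h), le_rfl,
        fun ξ h1 h2 => absurd h1 (not_le.2 h2)⟩
    · exact ⟨u, hu, huA, h⟩
  have hδu : δ < u.dom := hlt.trans_le hru.1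
  have hval : ∀ ξ < δ + 1, (u.val ξ : ℤ) = s₁ ξ + η.step ξ := fun ξ hξ => by
    rw [← hru.2 ξ hξ, hrv ξ hξ]
  have hge : ∀ ξ < u.dom, η.step ξ ≤ u.val ξ := fun ξ hξ => by
    rcases lt_or_ge ξ (δ + 1) with h | h
    · have := hval ξ h
      omega
    · rw [η.step_eq_of_le hη (hlt.le.trans h)]
      have := hui ξ h hξ
      omega
  have hteq : ∀ ξ < u.dom, (u.val ξ : ℤ) = (u.val ξ - η.step ξ).toNat + η.step ξ :=
    fun ξ hξ => by
      have := hge ξ hξ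
      omega
  obtain ⟨g, hg, e⟩ := hu.2
  obtain ⟨θ, -, hθ⟩ := RhoMod.exists_step_eq (zero_le.trans_lt hδ) hg hu.1.le
  refine ⟨θ, fun ξ => (u.val ξ - η.step ξ).toNat, u, hu, huA, hδu, ?_, fun ξ hξ => ?_, hteq,
    fun ξ hξ => by rw [e ξ hξ, hθ ξ hξ]⟩
  · exact (Coh.symm ⟨_, η.isStep_step, hteq⟩).trans ⟨g, hg, e⟩
  · have := hval ξ (hξ.trans hlt)
    have := hs₁s ξ hξ
    omega

/-- By regularity, the escapes from level `δ` can be found with lengths and codes below a bound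
that depends on `δ` and `η` only. -/
theorem IsCoherentSeq.exists_escape_bound (hb : IsCoherentSeq κ b) (hreg : κ.IsRegular)
    (hunc : Cardinal.aleph0 < κ) (hc : ∀ η θ α, α < κ.ord → c η θ α < κ.ord)
    (hA : IsSubtree (treeOf κ b) A) (hno : HasNoFrozenCone κ b A) (η : RhoMod κ) :
    ∃ f : Ordinal.{u} → Ordinal.{u}, ∀ δ < κ.ord, f δ < κ.ord ∧
      ((∀ d ∈ η.dom, d ≤ δ) → ∀ s, Coh δ s (b δ) → (∀ ξ < δ, 0 ≤ (s ξ : ℤ) + η.step ξ) →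
        ∃ θ t u, IsEscape b A η δ s θ t u ∧ u.dom < f δ ∧ c η θ u.dom < f δ) := by
  have key : ∀ δ : Ordinal.{u}, ∃ o : Ordinal.{u}, δ < κ.ord → o < κ.ord ∧
      ((∀ d ∈ η.dom, d ≤ δ) → ∀ s, Coh δ s (b δ) → (∀ ξ < δ, 0 ≤ (s ξ : ℤ) + η.step ξ) →
        ∃ θ t u, IsEscape b A η δ s θ t u ∧ u.dom < o ∧ c η θ u.dom < o) := by
    intro δ
    by_cases hδ : δ < κ.ord
    swap
    · exact ⟨0, fun h => absurd h hδ⟩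
    by_cases hη : ∀ d ∈ η.dom, d ≤ δ
    swap
    · exact ⟨0, fun _ => ⟨zero_le.trans_lt hδ, fun h => absurd h hη⟩⟩
    have hx : ∀ x : {ζ : RhoMod κ // ∀ d ∈ ζ.dom, d < δ + 1}, ∃ o < κ.ord,
        ∀ s : Ordinal.{u} → ℕ, (∀ ξ < δ, (s ξ : ℤ) = b δ ξ + x.1.step ξ) →
          (∀ ξ < δ, 0 ≤ (s ξ : ℤ) + η.step ξ) →
          ∃ θ t u, IsEscape b A η δ s θ t u ∧ u.dom ≤ o ∧ c η θ u.dom ≤ o := by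
      intro x
      by_cases hs : ∃ s : Ordinal.{u} → ℕ, (∀ ξ < δ, (s ξ : ℤ) = b δ ξ + x.1.step ξ) ∧
          ∀ ξ < δ, 0 ≤ (s ξ : ℤ) + η.step ξ
      · obtain ⟨s, hs1, hs2⟩ := hs
        obtain ⟨θ, t, u, hu⟩ := hb.exists_isEscape hreg.aleph0_le hA hno hδ hη
          ⟨_, x.1.isStep_step, hs1⟩ hs2
        refine ⟨max u.dom (c η θ u.dom), max_lt hu.mem.1 (hc _ _ _ hu.mem.1),
          fun s' hs' _ => ⟨θ, t, u, { hu with eq_of_lt := fun ξ hξ => ?_ }, le_max_left _ _,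
            le_max_right _ _⟩⟩
        rw [hu.eq_of_lt ξ hξ]
        exact_mod_cast (hs1 ξ hξ).trans (hs' ξ hξ).symm
      · exact ⟨0, zero_le.trans_lt hδ, fun s h1 h2 => absurd ⟨s, h1, h2⟩ hs⟩
    choose F hF1 hF2 using hx
    obtain ⟨o, ho, hFo⟩ := exists_bound hreg
      (RhoMod.mk_dom_subset_lt hunc (add_one_lt_ord hreg.aleph0_le hδ)) F hF1
    refine ⟨o, fun _ => ⟨ho, fun _ s hs hnn => ?_⟩⟩
    obtain ⟨g, hg, e⟩ := hs
    obtain ⟨x, hx1, hx2⟩ := RhoMod.exists_step_eq (zero_le.trans_lt hδ) hg hδ.le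
    have hx : ∀ d ∈ x.dom, d < δ + 1 := fun d hd => by
      rcases hx1 d hd with h | rfl
      · exact h.trans (lt_add_one δ)
      · exact zero_le.trans_lt (lt_add_one δ)
    obtain ⟨θ, t, u, hu, h1, h2⟩ := hF2 ⟨x, hx⟩ s
      (fun ξ hξ => by rw [e ξ hξ, hx2 ξ hξ]) hnn
    exact ⟨θ, t, u, hu, h1.trans_lt (hFo _), h2.trans_lt (hFo _)⟩
  choose f hf using key
  exact ⟨f, hf⟩

/-- The set of codes of the nodes outside `A`, tagged with the modification `η`. -/
def outsideCodes (c : RhoMod κ → RhoMod κ → Ordinal.{u} → Ordinal.{u})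
    (b : Ordinal.{u} → Ordinal.{u} → ℕ) (A : Set Node.{u}) (η : RhoMod κ) : Set Ordinal.{u} :=
  {x | ∃ θ, ∃ u ∈ treeOf κ b, u ∉ A ∧ (∀ ξ < u.dom, (u.val ξ : ℤ) = b u.dom ξ + θ.step ξ) ∧
    x = c η θ u.dom}

variable {C G : Ordinal.{u} → Set Ordinal.{u}}

/-- Let `β` be a point of `C α` with a predecessor `δ`, such that `G β` guesses the codes of the
nodes outside `A` and `β` is closed under a bound `f` for the escapes. Then a node of length `α`
that is the modification of the prescribed one by `η` does not belong to `A`, if `η` lives below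
`δ`: its restriction to `β` has been sealed. -/
theorem notMem_of_guess (hC : IsCoherentClubSeq κ C)
    (hb : IsCoherentSeq κ (seq C (sealRule c G)))
    (hcinj : ∀ η θ α η' θ' α', α < κ.ord → α' < κ.ord → c η θ α = c η' θ' α' →
      η = η' ∧ θ = θ' ∧ α = α')
    (hA : IsSubtree (treeOf κ (seq C (sealRule c G))) A) {η : RhoMod κ}
    {f : Ordinal.{u} → Ordinal.{u}}
    (hf : ∀ δ < κ.ord, f δ < κ.ord ∧
      ((∀ d ∈ η.dom, d ≤ δ) → ∀ s, Coh δ s (seq C (sealRule c G) δ) →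
        (∀ ξ < δ, 0 ≤ (s ξ : ℤ) + η.step ξ) →
        ∃ θ t u, IsEscape (seq C (sealRule c G)) A η δ s θ t u ∧ u.dom < f δ ∧
          c η θ u.dom < f δ))
    {a : Node.{u}} (ha : a ∈ treeOf κ (seq C (sealRule c G))) (hl : IsSuccLimit a.dom)
    (haη : ∀ ξ < a.dom, (a.val ξ : ℤ) = seq C (sealRule c G) a.dom ξ + η.step ξ)
    {β δ : Ordinal.{u}} (hβ : β ∈ C a.dom) (hδ : IsGreatest (C a.dom ∩ Iio β) δ)
    (hηδ : ∀ d ∈ η.dom, d ≤ δ)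
    (hguess : outsideCodes c (seq C (sealRule c G)) A η ∩ Iio β = G β)
    (hclosed : ∀ δ < β, f δ < β) : a ∉ A := by
  classical
  intro haA
  set b := seq C (sealRule c G) with hbdef
  have hβa : β < a.dom := hC.lt _ ha.1 hl β hβ
  have hβκ : β < κ.ord := hβa.trans ha.1
  have hδβ : δ < β := hδ.1.2
  have hδκ : δ < κ.ord := hδβ.trans hβκ
  obtain ⟨s, hs, hext⟩ := seq_eq_extension hC (sealRule_isSound G) ha.1 hl hβ hδ
  -- The extension rule meets a sealed candidate: an escape, lengthened to `β`.
  have hcand : ∃ t, IsAdmissible β (b β) δ s t ∧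
      IsSealed c (G β) β (seqBelow C (sealRule c G) β) t := by
    obtain ⟨θ, t, u, hu, hu1, hu2⟩ := (hf δ hδκ).2 hηδ s
      ((Coh.of_eq hs).trans (hb.coh _ ha.1 δ (hδβ.trans hβa).le))
      (fun ξ hξ => by
        rw [hs ξ hξ, ← hbdef, ← haη ξ (hξ.trans (hδβ.trans hβa))]
        positivity)
    have hfβ := hclosed δ hδβ
    have huβ : u.dom < β := hu1.trans hfβ
    have hρβ : u.dom + 1 < β := (add_one_le_iff.2 hu1).trans_lt hfβ
    obtain ⟨t', ht', htt', -⟩ := exists_extension (hb.lsc β hβκ) huβ.le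
      (hu.coh.trans (hb.coh β hβκ _ huβ.le).symm) 0
    refine ⟨Function.update t' (u.dom + 1) 0, .update ht' (fun ξ hξ => ?_)
      (hu.lt_dom.le.trans (lt_add_one _).le) hρβ (not_isSuccLimit_add_one _), η, θ, u.dom, huβ,
      ?_, fun ξ hξ => ?_⟩
    · rw [htt' ξ (hξ.trans hu.lt_dom), hu.eq_of_lt ξ hξ]
    · rw [← hguess]
      exact ⟨⟨θ, u, hu.mem, hu.notMem, hu.val_eq', rfl⟩, hu2.trans hfβ⟩
    · rw [Function.update_of_ne (hξ.trans (lt_add_one _)).ne, htt' ξ hξ, ← hu.val_eq ξ hξ,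
        seqBelow_of_lt huβ, hu.val_eq' ξ hξ]
  obtain ⟨η', θ', α', hα'β, hmem, heq⟩ := sealRule_isSealed hcand
  rw [← hguess] at hmem
  obtain ⟨θ, u, hu, huA, huv, hcode⟩ := hmem.1
  obtain ⟨rfl, rfl, rfl⟩ := hcinj _ _ _ _ _ _ (hα'β.trans hβκ) hu.1 hcode
  refine huA (hA.mem_of_le hu haA ⟨(hα'β.trans hβa).le, fun ξ hξ => ?_⟩)
  have h1 := heq ξ hξ
  rw [← hext ξ (hξ.trans hα'β), seqBelow_of_lt hα'β, ← hbdef, ← huv ξ hξ,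
    ← haη ξ (hξ.trans (hα'β.trans hβa))] at h1
  exact_mod_cast h1.symm

theorem isCoherentSeq_seq (hC : IsCoherentClubSeq κ C) {E : ExtensionRule.{u}} (hE : E.IsSound) :
    IsCoherentSeq κ (seq C E) where
  coh _ hα _ hβ := coh_seq hC hE hα hβ
  lsc _ hα := isLscAtLimits_seq_of_lt hC hE hα

/-- Every subtree of the tree constructed from the proxy sequence `C` and the diamond sequence `G`
contains a frozen cone. -/
theorem exists_frozenCone_subset (hreg : κ.IsRegular) (hunc : Cardinal.aleph0 < κ)
    {ξ : Ordinal.{u}} (hC : IsProxySequence ξ κ C)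
    (hG : ∀ X ⊆ Iio κ.ord, StationarilyMany κ fun α => X ∩ Iio α = G α)
    (hc : ∀ η θ α, α < κ.ord → c η θ α < κ.ord)
    (hcinj : ∀ η θ α η' θ' α', α < κ.ord → α' < κ.ord → c η θ α = c η' θ' α' →
      η = η' ∧ θ = θ' ∧ α = α')
    (hA : IsSubtree (treeOf κ (seq C (sealRule c G))) A) :
    ∃ s ∈ treeOf κ (seq C (sealRule c G)), s.dom ∈ nacc (Iio κ.ord) ∧
      ∃ i : ℕ, frozenCone (treeOf κ (seq C (sealRule c G))) s i ⊆ A := by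
  have hC' := hC.isCoherentClubSeq
  have hb := isCoherentSeq_seq hC' (sealRule_isSound (c := c) G)
  by_contra! hno
  have hno' : HasNoFrozenCone κ (seq C (sealRule c G)) A := hno
  have hκ := hreg.aleph0_le
  have hκ0 : 0 < κ.ord := Cardinal.ord_pos.2 hreg.pos
  choose f hf using hb.exists_escape_bound hreg hunc hc hA hno'
  -- The set attached to the code of `η`: the places where the guess for `η` is correct.
  let B : Ordinal.{u} → Set Ordinal.{u} := fun i => {β | β < κ.ord ∧ ∀ η, c η η 0 = i →
    outsideCodes c (seq C (sealRule c G)) A η ∩ Iio β = G β ∧ ∀ δ < β, f η δ < β}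
  have hB : ∀ i < κ.ord, IsCofinalSubset κ (B i) := by
    refine fun i _ => ⟨fun β hβ => hβ.1, fun γ hγ => ?_⟩
    by_cases hi : ∃ η : RhoMod κ, c η η 0 = i
    · obtain ⟨η, rfl⟩ := hi
      have hsub : outsideCodes c (seq C (sealRule c G)) A η ⊆ Iio κ.ord := by
        rintro x ⟨θ, u, hu, -, -, rfl⟩
        exact hc _ _ _ hu.1
      obtain ⟨β, hβ, hγβ, h1, h2⟩ := (hG _ hsub).exists_closed hreg hunc (f η)
        (fun δ hδ => (hf η δ hδ).1) hγ
      refine ⟨β, ⟨hβ, fun η' hη' => ?_⟩, hγβ.le⟩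
      obtain ⟨rfl, -, -⟩ := hcinj _ _ _ _ _ _ hκ0 hκ0 hη'
      exact ⟨h1, h2⟩
    · exact ⟨γ, ⟨hγ, fun η h => absurd ⟨η, h⟩ hi⟩, le_rfl⟩
  -- Below a closure point `α` of `F`, all modifications that live below `α` have codes below `α`.
  have hF : ∀ δ : Ordinal.{u}, ∃ o : Ordinal.{u}, δ < κ.ord → o < κ.ord ∧ δ < o ∧
      ∀ η : RhoMod κ, (∀ d ∈ η.dom, d ≤ δ) → c η η 0 < o := by
    intro δ
    by_cases hδ : δ < κ.ord
    · have hδ1 := add_one_lt_ord hκ hδ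
      obtain ⟨o, ho, h⟩ := exists_bound hreg (RhoMod.mk_dom_subset_lt hunc hδ1)
        (fun η => c η.1 η.1 0) (fun η => hc _ _ _ hκ0)
      exact ⟨max o (δ + 1), fun _ => ⟨max_lt ho hδ1, lt_max_of_lt_right (lt_add_one δ),
        fun η hη => lt_max_of_lt_left (h ⟨η, fun d hd => lt_add_one_iff.2 (hη d hd)⟩)⟩⟩
    · exact ⟨0, fun h => absurd h hδ⟩
  choose F hF using hF
  obtain ⟨α, hα, hα0, hhit, hclosed⟩ := (hC.hitting B hB).exists_closed hreg hunc F
    (fun δ hδ => (hF δ hδ).1) hκ0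
  have hl : IsSuccLimit α := by
    refine Ordinal.isSuccLimit_iff.2 ⟨hα0.ne', isSuccPrelimit_of_succ_lt fun γ hγ => ?_⟩
    exact (succ_le_of_lt (hF γ (hγ.trans hα)).2.1).trans_lt (hclosed γ hγ)
  obtain ⟨a, haA, rfl⟩ := hA.level_nonempty (hb.isStreamlinedTree hreg hunc) hα
  have ha := hA.1 haA
  obtain ⟨g, hg, e⟩ := ha.2
  obtain ⟨η, hηdom, hη⟩ := RhoMod.exists_step_eq hκ0 hg hα.le
  obtain ⟨δ₀, hδ₀, hηδ₀⟩ : ∃ δ₀ < a.dom, ∀ d ∈ η.dom, d ≤ δ₀ := by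
    refine ⟨η.dom.sup id, (Finset.sup_lt_iff hα0).2 fun d hd => ?_,
      fun d hd => Finset.le_sup (f := id) hd⟩
    rcases hηdom d hd with h | rfl
    exacts [h, hα0]
  have hlub := hhit (c η η 0) (((hF δ₀ (hδ₀.trans hα)).2.2 η hηδ₀).trans (hclosed δ₀ hδ₀))
  obtain ⟨δ₁, hδ₁, hδ₀₁⟩ := hC'.unbounded _ hα hl δ₀ hδ₀
  obtain ⟨β, ⟨⟨hβC, hβacc⟩, hβB⟩, hδ₁β⟩ := (lt_isLUB_iff hlub).1 (hC'.lt _ hα hl δ₁ hδ₁)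
  obtain ⟨δ, hδ⟩ := (hC'.isGreatest_or_mem_acc hα hl hβC ⟨δ₁, hδ₁, hδ₁β⟩).resolve_right hβacc
  have hδ₀δ : δ₀ ≤ δ := hδ₀₁.trans (hδ.2 ⟨hδ₁, hδ₁β⟩)
  obtain ⟨hguess, hcl⟩ := hβB.2 η rfl
  exact notMem_of_guess hC' hb hcinj hA (hf η) ha hl
    (fun ξ hξ => by rw [e ξ hξ, hη ξ hξ]) hβC hδ (fun d hd => (hηδ₀ d hd).trans hδ₀δ) hguess hcl
    haA

end Sealing

end ProxyTree

theorem mainTheorem3 (κ : Cardinal.{u}) (hreg : κ.IsRegular) (hunc : Cardinal.aleph0 < κ)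
    (hP : ProxyTree.Proxy κ) :
    ∃ T : Set ProxyTree.Node.{u},
      ProxyTree.IsAronszajnTree κ T ∧
      ProxyTree.IsUniformlyRhoCoherent κ T ∧
      ¬ ProxyTree.IsSouslinTree κ T ∧
      ∀ A : Set ProxyTree.Node.{u}, ProxyTree.IsSubtree T A →
        ∃ s ∈ T, s.dom ∈ ProxyTree.nacc (Set.Iio κ.ord) ∧
          ∃ i : ℕ, ProxyTree.frozenCone T s i ⊆ A := by
  obtain ⟨⟨C, hC⟩, G, -, hG⟩ := hP
  obtain ⟨c, hc, hcinj⟩ := ProxyTree.exists_code hunc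
  have hb := ProxyTree.isCoherentSeq_seq hC.isCoherentClubSeq
    (ProxyTree.sealRule_isSound (c := c) G)
  have hcone := fun A => ProxyTree.exists_frozenCone_subset (A := A) hreg hunc hC hG hc hcinj
  exact ⟨_, hb.isAronszajnTree hreg hunc hcone,
    ProxyTree.treeOf_isUniformlyRhoCoherent (Cardinal.ord_pos.2 hreg.pos),
    ProxyTree.treeOf_not_isSouslinTree hreg.aleph0_le, hcone⟩
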